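/- **Setting.** Let $\mathcal A$ be a finite alphabet and $\mathcal A^*$ the free monoid of finite words over it. A map $\varphi:\mathcal A^*\to\mathcal A^*$ is a *morphism* if $\varphi(vw)=\varphi(v)\varphi(w)$ and an *antimorphism* if $\varphi(vw)=\varphi(w)\varphi(v)$ for all $v,w$. Let $G$ be a finite group (under composition, with the identity map as unit) consisting of morphisms and antimorphisms of $\mathcal A^*$ and containing at least one antimorphism. Write $[w]=\{\mu(w):\mu\in G\}$. A word $w$ is a *$G$-palindrome* if $\Theta(w)=w$ for some antimorphism $\Theta\in G$. Let $\mathbf u=(u_n)_{n\in\mathbb N}\in\mathcal A^{\mathbb N}$ be an infinite word and $\mathcal L(\mathbf u)$ its language, i.e. the set of its finite factors. The language is *closed under $G$* if $\mu(w)\in\mathcal L(\mathbf u)$ for all $w\in\mathcal L(\mathbf u)$ and $\mu\in G$. A *complete return word* of $w\in\mathcal L(\mathbf u)$ is a factor of $\mathbf u$ containing exactly two occurrences of $w$, one as a prefix and one as a suffix; $\mathbf u$ is *uniformly recurrent* if each of its factors has only finitely many complete return words. **Richness.** A factor $w$ is *special* if there are at least two letters $a$ with $aw\in\mathcal L(\mathbf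 u)$ or at least two letters $a$ with $wa\in\mathcal L(\mathbf u)$. Suppose $\mathcal L(\mathbf u)$ is closed under $G$. The graph of symmetries $\Gamma_n(\mathbf u)$ is the undirected multigraph (loops allowed) whose vertices are the classes $[w]$ of special factors $w$ of length $n$, and whose edges are the classes $[e]$ of those factors $e$ of $\mathbf u$ with $|e|>n$ that contain exactly two occurrences of special factors of length $n$, namely the prefix $w$ and the suffix $v$ of $e$ of length $n$; the edge $[e]$ joins $[w]$ and $[v]$. The word $\mathbf u$ has *Property $G$-tls$(N)$* if $\mathcal L(\mathbf u)$ is closed under $G$ and for every $n\ge N$: whenever $[e]$ is a loop of $\Gamma_n(\mathbf u)$, $e$ is a $G$-palindrome; and the graph obtained from $\Gamma_n(\mathbf u)$ by removing loops is a tree (the graph without vertices being counted as a tree). The word $\mathbf u$ is *$G$-rich* if it has Property $G$-tls$(1)$, and *almost $G$-rich* if it has Property $G$-tls$(N)$ for some $N\in\mathbb N$. **Defect.** For a finite word $w$ put $$D_G(w)=|w|+1-\#\mathrm{Pal}_G(w)-\gamma_G(w),$$ where $\mathrm{Pal}_G(w)=\{[v] : v \text{ is a factor of } w \text{ and a } G\text{-palindrome}\}$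 (the empty word included) and $\gamma_G(w)=\#\{[a] : a\in\mathcal A \text{ occurs in } w \text{ and } \Theta(a)\ne a \text{ for every antimorphism } \Theta\in G\}$. For the infinite word put $D_G(\mathbf u)=\sup_{w\in\mathcal L(\mathbf u)}D_G(w)$, which may be $+\infty$. **Theorem.** Let $\mathbf u$ be an infinite word with language closed under $G$. 1. $D_G(\mathbf u)=0$ if and only if $\mathbf u$ is $G$-rich. 2. If $\mathbf u$ is uniformly recurrent, then $D_G(\mathbf u)$ is finite if and only if $\mathbf u$ is almost $G$-rich. -/

import Mathlib

namespace SymWords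

variable {A : Type*}

/-! ### Words, factors and languages -/

/-- `i` is an occurrence of the finite word `w` in the finite word `v`. -/
def OccursAt (w v : List A) (i : ℕ) : Prop :=
  i + w.length ≤ v.length ∧ (v.drop i).take w.length = w

/-- The factor `u_i u_{i+1} ⋯ u_{i+n-1}` of the infinite word `u`. -/
def factorAt (u : ℕ → A) (i n : ℕ) : List A :=
  (List.range n).map (fun k => u (i + k))

/-- The language of an infinite word: the set of all its (finite) factors. -/
def language (u : ℕ → A) : Set (List A) :=
  {w | ∃ i n, w = factorAt u i n}

/-- `v` is a complete return word of `w` in `u`: it is a factor of `u` in which `w` has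
exactly two occurrences, one as a prefix and one as a suffix. -/
def IsCompleteReturn (u : ℕ → A) (w v : List A) : Prop :=
  v ∈ language u ∧ w.length < v.length ∧
    ∀ i, OccursAt w v i ↔ i = 0 ∨ i = v.length - w.length

/-- Every factor of `u` has only finitely many complete return words (equivalently, return
words). -/
def IsUniformlyRecurrent (u : ℕ → A) : Prop :=
  ∀ w ∈ language u, {v | IsCompleteReturn u w v}.Finite

/-! ### Morphisms, antimorphisms and groups of symmetries -/

/-- Morphisms of the free monoid of words. -/
def IsMorphism (f : List A → List A) : Prop :=
  ∀ v w, f (v ++ w) = f v ++ f w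

/-- Antimorphisms of the free monoid of words. -/
def IsAntimorphism (f : List A → List A) : Prop :=
  ∀ v w, f (v ++ w) = f w ++ f v

/-- `G` is a finite group, under composition, of morphisms and antimorphisms of the free
monoid, and it contains at least one antimorphism. -/
structure IsSymmetryGroup (G : Subgroup (Equiv.Perm (List A))) : Prop where
  finite : Finite G
  morphism_or_antimorphism : ∀ g ∈ G, IsMorphism g ∨ IsAntimorphism g
  exists_antimorphism : ∃ g ∈ G, IsAntimorphism g

/-- The class `[w] = {μ(w) | μ ∈ G}` of `G`-equivalence of the word `w`. -/
def cls (G : Subgroup (Equiv.Perm (List A))) (w : List A) : Set (List A) :=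
  {v | ∃ g ∈ G, v = g w}

/-- `w` is a `G`-palindrome: it is fixed by some antimorphism in `G`. -/
def IsGPalindrome (G : Subgroup (Equiv.Perm (List A))) (w : List A) : Prop :=
  ∃ g ∈ G, IsAntimorphism g ∧ g w = w

/-- The language of `u` is closed under `G`. -/
def ClosedUnder (G : Subgroup (Equiv.Perm (List A))) (u : ℕ → A) : Prop :=
  ∀ w ∈ language u, ∀ g ∈ G, g w ∈ language u

/-! ### Graphs of symmetries -/

/-- `w` is a left special or right special factor of `u`: it has at least two left
extensions, or at least two right extensions. -/
def IsSpecial (u : ℕ → A) (w : List A) : Prop :=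
  w ∈ language u ∧
    ({a | a :: w ∈ language u}.Nontrivial ∨ {a | w ++ [a] ∈ language u}.Nontrivial)

/-- The vertices of the graph of symmetries of order `n`: classes of special factors of
length `n`. -/
def vertexSet (G : Subgroup (Equiv.Perm (List A))) (u : ℕ → A) (n : ℕ) : Set (Set (List A)) :=
  {x | ∃ w, w.length = n ∧ IsSpecial u w ∧ x = cls G w}

/-- The factor `e` of `u` contains exactly two occurrences of special factors of length `n`:
its prefix and its suffix. These are the edges of the directed graph of symmetries. -/
structure IsEdgeWord (u : ℕ → A) (n : ℕ) (e : List A) : Prop where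
  mem_language : e ∈ language u
  length_gt : n < e.length
  special_iff : ∀ i, i + n ≤ e.length →
    (IsSpecial u ((e.drop i).take n) ↔ i = 0 ∨ i = e.length - n)

/-- The directed edge `e` starts in the class of its prefix of length `n`. -/
def source (G : Subgroup (Equiv.Perm (List A))) (n : ℕ) (e : List A) : Set (List A) :=
  cls G (e.take n)

/-- The directed edge `e` ends in the class of its suffix of length `n`. -/
def target (G : Subgroup (Equiv.Perm (List A))) (n : ℕ) (e : List A) : Set (List A) :=
  cls G (e.drop (e.length - n))

/-- The class `E` is an edge between `x` and `y` in the undirected graph of symmetries of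
order `n` (a multigraph with loops): `E = [e]` for a directed edge `e` that starts in `x` and
ends in `y` or vice versa. -/
def IsLink (G : Subgroup (Equiv.Perm (List A))) (u : ℕ → A) (n : ℕ)
    (E x y : Set (List A)) : Prop :=
  ∃ e, IsEdgeWord u n e ∧ E = cls G e ∧
    ((source G n e = x ∧ target G n e = y) ∨ (source G n e = y ∧ target G n e = x))

/-- The simple graph on the vertices of the undirected graph of symmetries of order `n`, in
which two distinct vertices are adjacent when at least one edge joins them. -/
def simpleSymGraph (G : Subgroup (Equiv.Perm (List A))) (u : ℕ → A) (n : ℕ) :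
    SimpleGraph (vertexSet G u n) where
  Adj x y := x ≠ y ∧ ∃ E, IsLink G u n E x y
  symm := ⟨fun _ _ h => ⟨h.1.symm, by
    obtain ⟨E, e, he, hE, h'⟩ := h.2
    exact ⟨E, e, he, hE, h'.symm⟩⟩⟩
  loopless := ⟨fun _ h => h.1 rfl⟩

/-- The multigraph obtained from the undirected graph of symmetries of order `n` by removing
loops is a tree: distinct vertices are joined by at most one edge, and the graph is connected
and has no cycles. The graph without vertices (which occurs for periodic words, when there is
no special factor of length `n`) is counted as a tree. -/
def LooplessIsTree (G : Subgroup (Equiv.Perm (List A))) (u : ℕ → A) (n : ℕ) : Prop :=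
  (∀ x ∈ vertexSet G u n, ∀ y ∈ vertexSet G u n, x ≠ y →
    ∀ E E', IsLink G u n E x y → IsLink G u n E' x y → E = E') ∧
  (simpleSymGraph G u n).Preconnected ∧ (simpleSymGraph G u n).IsAcyclic

/-- Every loop `[e]` of the undirected graph of symmetries of order `n` consists of
`G`-palindromes. -/
def LoopsArePalindromes (G : Subgroup (Equiv.Perm (List A))) (u : ℕ → A) (n : ℕ) : Prop :=
  ∀ e, IsEdgeWord u n e → source G n e = target G n e → IsGPalindrome G e

/-- The property `G`-tls(`N`) (tree-like structure from order `N` on). -/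
structure HasTLS (G : Subgroup (Equiv.Perm (List A))) (N : ℕ) (u : ℕ → A) : Prop where
  closed : ClosedUnder G u
  loops : ∀ n, N ≤ n → LoopsArePalindromes G u n
  tree : ∀ n, N ≤ n → LooplessIsTree G u n

/-- `u` is `G`-rich. -/
def IsGRich (G : Subgroup (Equiv.Perm (List A))) (u : ℕ → A) : Prop :=
  HasTLS G 1 u

/-- `u` is almost `G`-rich. -/
def IsAlmostGRich (G : Subgroup (Equiv.Perm (List A))) (u : ℕ → A) : Prop :=
  ∃ N, HasTLS G N u

/-! ### The `G`-defect -/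

/-- The set of classes of `G`-palindromic factors of `w` (the empty word included). -/
def palClasses (G : Subgroup (Equiv.Perm (List A))) (w : List A) : Set (Set (List A)) :=
  {x | ∃ v, v <:+: w ∧ IsGPalindrome G v ∧ x = cls G v}

/-- The set of classes `[a]` of letters `a` that occur in `w` and are fixed by no antimorphism
in `G`. -/
def unfixedLetterClasses (G : Subgroup (Equiv.Perm (List A))) (w : List A) :
    Set (Set (List A)) :=
  {x | ∃ a ∈ w, (∀ g ∈ G, IsAntimorphism g → g [a] ≠ [a]) ∧ x = cls G [a]}

/-- `γ_G(w)`. -/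
noncomputable def gammaG (G : Subgroup (Equiv.Perm (List A))) (w : List A) : ℕ :=
  (unfixedLetterClasses G w).ncard

/-- The `G`-defect of a finite word, `D_G(w) = |w| + 1 - #Pal_G(w) - γ_G(w)`. -/
noncomputable def defect (G : Subgroup (Equiv.Perm (List A))) (w : List A) : ℤ :=
  (w.length : ℤ) + 1 - ((palClasses G w).ncard : ℤ) - (gammaG G w : ℤ)

/-- The `G`-defect of an infinite word: the supremum, possibly infinite, of the `G`-defects of
its factors. -/
noncomputable def infDefect (G : Subgroup (Equiv.Perm (List A))) (u : ℕ → A) : EReal :=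
  ⨆ w ∈ language u, (((defect G w : ℤ) : ℝ) : EReal)

end SymWords

/-!
The two parts of the theorem are reduced to one property of the infinite word `u`, with a bound
`N` on the length: from length `N` on, the factor of `u` spanned by two consecutive occurrences
of elements of one class `[w]` (a complete return to `[w]`) is a `G`-palindrome. This is
`ReturnsArePalindromes G N u`. Factors are addressed by their positions in `u`, and `u` is
recurrent because its language is closed under an antimorphism (`exists_occurrence_ge`).

*Returns and defect.* Appending a letter to a factor adds at most one class of palindromes, that
of the longest palindromic suffix, or one class of unfixed letters, but never both. So the defect
is monotone, and it stays the same exactly when one of the two is new (`defect_succ_le_iff`). If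
it stays the same at the end of a complete return, the new palindromic suffix must be the whole
complete return (`antiEquiv_of_defect_le`); conversely, if complete returns are palindromes, the
longest palindromic suffix of a prefix of `u` is new as soon as the class of some suffix of
length `N` has occurred before (`defect_prefix_succ_le`). Hence defect zero corresponds to `N = 1`
(`infDefect_eq_zero_iff`). For finite defect, uniform recurrence puts a factor of maximal defect
into every long factor, and in the other direction there are only finitely many words of length
`N` (`infDefect_lt_top_iff`).

*From the graphs to returns.* Let `w` of length `n` occur at consecutive positions `i < j` of its
class. If `w` is special, `u` leaves `[w]` either along a loop, which is a palindrome, or along a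
bridge, and then it has to come back along the same bridge (`LooplessIsTree.exists_return`). In
the second case an antimorphism matches the first and the last `n + 1` letters of the return, so
that it is also a complete return to the class of a longer word, with a smaller distance of the
two occurrences; this induction is `antiEquiv_of_consecutive`. It also covers words that are not
special, if an antimorphism exchanges the two occurrences. That there is such an antimorphism is
shown in `antiEquiv_of_no_special` and `antiEquiv_of_special_around`, again by the bridge argument.

*From returns to the graphs.* Loops are complete returns. For the tree, fix a vertex `x` and
record, for a visit of `u` to another vertex `z`, the edge by which `u` last left `x`
(`BranchAt`). Since the excursions of `u` from `x` and from `z` are palindromes, this edge depends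
on `z` alone (`BranchAt.unique`). So the set of vertices in the branch of an edge at `x` can be
left only through this edge, which is therefore a bridge and not part of a multiple edge
(`looplessIsTree_of_returns`).
-/

namespace SymWords

variable {A : Type*}

/-! ### Factors of an infinite word -/

theorem factorAt_length (u : ℕ → A) (i n : ℕ) : (factorAt u i n).length = n := by
  simp [factorAt]

theorem factorAt_add (u : ℕ → A) (i m n : ℕ) :
    factorAt u i (m + n) = factorAt u i m ++ factorAt u (i + m) n := by
  simp [factorAt, List.range_add, Function.comp_def, Nat.add_assoc]

theorem factorAt_zero (u : ℕ → A) (i : ℕ) : factorAt u i 0 = [] := rfl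

theorem factorAt_one (u : ℕ → A) (i : ℕ) : factorAt u i 1 = [u i] := by
  simp [factorAt]

theorem factorAt_succ (u : ℕ → A) (i n : ℕ) :
    factorAt u i (n + 1) = factorAt u i n ++ [u (i + n)] := by
  rw [factorAt_add, factorAt_one]

theorem factorAt_succ' (u : ℕ → A) (i n : ℕ) :
    factorAt u i (n + 1) = u i :: factorAt u (i + 1) n := by
  rw [Nat.add_comm n 1, factorAt_add, factorAt_one]; rfl

theorem factorAt_mem (u : ℕ → A) (i n : ℕ) : factorAt u i n ∈ language u := ⟨i, n, rfl⟩

/-- A factor `u_k ⋯ u_{k+m-1}` inside `u_i ⋯ u_{i+n-1}`, with the words on its two sides. -/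
theorem factorAt_split (u : ℕ → A) {i n k m : ℕ} (h₁ : i ≤ k) (h₂ : k + m ≤ i + n) :
    factorAt u i n =
      factorAt u i (k - i) ++ factorAt u k m ++ factorAt u (k + m) (i + n - (k + m)) := by
  obtain ⟨a, rfl⟩ := Nat.exists_eq_add_of_le h₁
  obtain ⟨b, hb⟩ := Nat.exists_eq_add_of_le h₂
  have : n = a + m + b := by omega
  subst this
  rw [factorAt_add, factorAt_add, show i + a - i = a by omega,
    show i + (a + m + b) - (i + a + m) = b by omega, Nat.add_assoc i a m]

theorem drop_take_factorAt (u : ℕ → A) {i n k m : ℕ} (h : k + m ≤ n) :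
    ((factorAt u i n).drop k).take m = factorAt u (i + k) m := by
  rw [factorAt_split u (i := i) (n := n) (k := i + k) (m := m) (by omega) (by omega),
    List.append_assoc, List.drop_append_of_le_length (by simp [factorAt_length]),
    List.drop_of_length_le (by simp [factorAt_length]), List.nil_append,
    List.take_append_of_le_length (by simp [factorAt_length]),
    List.take_of_length_le (by simp [factorAt_length])]

theorem factorAt_infix (u : ℕ → A) {i n k m : ℕ} (h₁ : i ≤ k) (h₂ : k + m ≤ i + n) :
    factorAt u k m <:+: factorAt u i n :=
  ⟨_, _, (factorAt_split u h₁ h₂).symm⟩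

/-- An infix of a factor of `u` sits at a definite position. -/
theorem exists_factorAt_of_infix {u : ℕ → A} {i n : ℕ} {v : List A}
    (h : v <:+: factorAt u i n) :
    ∃ k, i ≤ k ∧ k + v.length ≤ i + n ∧ v = factorAt u k v.length := by
  obtain ⟨s, t, hst⟩ := h
  have hlen : s.length + v.length + t.length = n := by
    have := congrArg List.length hst
    simpa [factorAt_length, Nat.add_assoc] using this
  refine ⟨i + s.length, by omega, by omega, ?_⟩
  rw [← drop_take_factorAt u (n := n) (by omega), ← hst, List.append_assoc, List.drop_left,
    List.take_left]

/-! ### Symmetries preserve length -/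

theorem IsMorphism.map_nil {g : List A → List A} (hg : IsMorphism g) : g [] = [] := by
  have := congrArg List.length (hg [] [])
  simp at this
  simpa using this

theorem IsAntimorphism.map_nil {g : List A → List A} (hg : IsAntimorphism g) : g [] = [] := by
  have := congrArg List.length (hg [] [])
  simp at this
  simpa using this

theorem IsMorphism.inv {g : Equiv.Perm (List A)} (hg : IsMorphism g) :
    IsMorphism (g⁻¹ : Equiv.Perm (List A)) := fun v w => by
  apply g.injective
  rw [hg]
  simp

theorem IsAntimorphism.inv {g : Equiv.Perm (List A)} (hg : IsAntimorphism g) :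
    IsAntimorphism (g⁻¹ : Equiv.Perm (List A)) := fun v w => by
  apply g.injective
  rw [hg]
  simp

theorem IsMorphism.mul {g h : Equiv.Perm (List A)} (hg : IsMorphism g) (hh : IsMorphism h) :
    IsMorphism (g * h : Equiv.Perm (List A)) := fun v w => by
  simp [hh v w, hg (h v) (h w)]

theorem IsMorphism.mul_anti {g h : Equiv.Perm (List A)} (hg : IsMorphism g)
    (hh : IsAntimorphism h) : IsAntimorphism (g * h : Equiv.Perm (List A)) := fun v w => by
  simp [hh v w, hg (h w) (h v)]

theorem IsAntimorphism.mul_mor {g h : Equiv.Perm (List A)} (hg : IsAntimorphism g)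
    (hh : IsMorphism h) : IsAntimorphism (g * h : Equiv.Perm (List A)) := fun v w => by
  simp [hh v w, hg (h v) (h w)]

theorem IsAntimorphism.mul_anti {g h : Equiv.Perm (List A)} (hg : IsAntimorphism g)
    (hh : IsAntimorphism h) : IsMorphism (g * h : Equiv.Perm (List A)) := fun v w => by
  simp [hh v w, hg (h w) (h v)]

/-- An injective morphism or antimorphism erases no letter. -/
theorem length_le_of_symmetry {g : Equiv.Perm (List A)}
    (hg : IsMorphism g ∨ IsAntimorphism g) (w : List A) : w.length ≤ (g w).length := by
  have hnil : g [] = [] := hg.elim IsMorphism.map_nil IsAntimorphism.map_nil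
  induction w with
  | nil => simp
  | cons a w ih =>
    have ha : 0 < (g [a]).length := by
      rw [List.length_pos_iff]
      intro h
      have := g.injective (h.trans hnil.symm)
      simp at this
    have : (g (a :: w)).length = (g [a]).length + (g w).length := by
      rcases hg with hg | hg
      · rw [← List.singleton_append, hg, List.length_append]
      · rw [← List.singleton_append, hg, List.length_append, Nat.add_comm]
    simp only [List.length_cons]
    omega

theorem length_symmetry {g : Equiv.Perm (List A)}
    (hg : IsMorphism g ∨ IsAntimorphism g) (w : List A) : (g w).length = w.length := by
  refine le_antisymm ?_ (length_le_of_symmetry hg w)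
  have := length_le_of_symmetry (g := g⁻¹) (hg.imp IsMorphism.inv IsAntimorphism.inv) (g w)
  simpa using this

/-- A morphism between factors restricts to the parts of these factors with equal offsets from
the left end. -/
theorem IsMorphism.restrict {g : Equiv.Perm (List A)} (hg : IsMorphism g) {u : ℕ → A}
    {i j n i' j' m : ℕ} (h : g (factorAt u i n) = factorAt u j n)
    (h₁ : i ≤ i') (h₂ : i' + m ≤ i + n) (h₃ : i' + j = i + j') :
    g (factorAt u i' m) = factorAt u j' m := by
  have hl := length_symmetry (Or.inl hg)
  rw [factorAt_split u h₁ h₂, factorAt_split u (i := j) (k := j') (m := m) (by omega) (by omega),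
    hg, hg] at h
  have h4 := (List.append_inj h (by simp [hl, factorAt_length]; omega)).1
  exact (List.append_inj h4 (by simp [hl, factorAt_length]; omega)).2

/-- An antimorphism between factors restricts to mirrored parts of these factors: the offset of
one from the left end is the offset of the other from the right end. -/
theorem IsAntimorphism.restrict {g : Equiv.Perm (List A)} (hg : IsAntimorphism g) {u : ℕ → A}
    {i j n i' j' m : ℕ} (h : g (factorAt u i n) = factorAt u j n)
    (h₁ : i ≤ i') (h₂ : i' + m ≤ i + n) (h₃ : i' + j' + m = i + j + n) :
    g (factorAt u i' m) = factorAt u j' m := by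
  have hl := length_symmetry (Or.inr hg)
  rw [factorAt_split u h₁ h₂, factorAt_split u (i := j) (k := j') (m := m) (by omega) (by omega),
    hg, hg, ← List.append_assoc] at h
  have h4 := (List.append_inj h (by simp [hl, factorAt_length]; omega)).1
  exact (List.append_inj h4 (by simp [hl, factorAt_length]; omega)).2

/-! ### Equivalence of positions -/

variable {G : Subgroup (Equiv.Perm (List A))} {u : ℕ → A}

/-- A morphism in `G` carries the factor of length `n` at position `i` to the one at `j`. -/
def MorEquiv (G : Subgroup (Equiv.Perm (List A))) (u : ℕ → A) (n i j : ℕ) : Prop :=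
  ∃ g ∈ G, IsMorphism g ∧ g (factorAt u i n) = factorAt u j n

/-- An antimorphism in `G` carries the factor of length `n` at position `i` to the one at `j`.
In particular `AntiEquiv G u n i i` says that the factor at `i` is a `G`-palindrome. -/
def AntiEquiv (G : Subgroup (Equiv.Perm (List A))) (u : ℕ → A) (n i j : ℕ) : Prop :=
  ∃ g ∈ G, IsAntimorphism g ∧ g (factorAt u i n) = factorAt u j n

/-- The factors of length `n` at positions `i` and `j` are in the same class. -/
def SameClass (G : Subgroup (Equiv.Perm (List A))) (u : ℕ → A) (n i j : ℕ) : Prop :=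
  cls G (factorAt u i n) = cls G (factorAt u j n)

theorem cls_eq_iff {v w : List A} : cls G v = cls G w ↔ ∃ g ∈ G, g v = w := by
  constructor
  · intro h
    have : w ∈ cls G w := ⟨1, G.one_mem, rfl⟩
    rw [← h] at this
    obtain ⟨g, hg, rfl⟩ := this
    exact ⟨g, hg, rfl⟩
  · rintro ⟨g, hg, rfl⟩
    ext x
    constructor
    · rintro ⟨k, hk, rfl⟩
      exact ⟨k * g⁻¹, G.mul_mem hk (G.inv_mem hg), by simp⟩
    · rintro ⟨k, hk, rfl⟩
      exact ⟨k * g, G.mul_mem hk hg, by simp⟩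

theorem MorEquiv.refl (n i : ℕ) : MorEquiv G u n i i :=
  ⟨1, G.one_mem, fun _ _ => rfl, rfl⟩

theorem MorEquiv.symm {n i j : ℕ} (h : MorEquiv G u n i j) : MorEquiv G u n j i := by
  obtain ⟨g, hg, hm, h⟩ := h
  exact ⟨g⁻¹, G.inv_mem hg, hm.inv, by rw [← h]; simp⟩

theorem AntiEquiv.symm {n i j : ℕ} (h : AntiEquiv G u n i j) : AntiEquiv G u n j i := by
  obtain ⟨g, hg, hm, h⟩ := h
  exact ⟨g⁻¹, G.inv_mem hg, hm.inv, by rw [← h]; simp⟩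

theorem MorEquiv.trans {n i j k : ℕ} (h : MorEquiv G u n i j) (h' : MorEquiv G u n j k) :
    MorEquiv G u n i k := by
  obtain ⟨g, hg, hm, h⟩ := h
  obtain ⟨g', hg', hm', h'⟩ := h'
  exact ⟨g' * g, G.mul_mem hg' hg, hm'.mul hm, by simp [h, h']⟩

theorem MorEquiv.trans_anti {n i j k : ℕ} (h : MorEquiv G u n i j)
    (h' : AntiEquiv G u n j k) : AntiEquiv G u n i k := by
  obtain ⟨g, hg, hm, h⟩ := h
  obtain ⟨g', hg', hm', h'⟩ := h'
  exact ⟨g' * g, G.mul_mem hg' hg, hm'.mul_mor hm, by simp [h, h']⟩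

theorem AntiEquiv.trans_mor {n i j k : ℕ} (h : AntiEquiv G u n i j)
    (h' : MorEquiv G u n j k) : AntiEquiv G u n i k :=
  (h'.symm.trans_anti h.symm).symm

theorem AntiEquiv.trans {n i j k : ℕ} (h : AntiEquiv G u n i j)
    (h' : AntiEquiv G u n j k) : MorEquiv G u n i k := by
  obtain ⟨g, hg, hm, h⟩ := h
  obtain ⟨g', hg', hm', h'⟩ := h'
  exact ⟨g' * g, G.mul_mem hg' hg, hm'.mul_anti hm, by simp [h, h']⟩

theorem MorEquiv.restrict {n i j m i' j' : ℕ} (h : MorEquiv G u n i j)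
    (h₁ : i ≤ i') (h₂ : i' + m ≤ i + n) (h₃ : i' + j = i + j') : MorEquiv G u m i' j' := by
  obtain ⟨g, hg, hm, h⟩ := h
  exact ⟨g, hg, hm, hm.restrict h h₁ h₂ h₃⟩

theorem AntiEquiv.restrict {n i j m i' j' : ℕ} (h : AntiEquiv G u n i j)
    (h₁ : i ≤ i') (h₂ : i' + m ≤ i + n) (h₃ : i' + j' + m = i + j + n) :
    AntiEquiv G u m i' j' := by
  obtain ⟨g, hg, hm, h⟩ := h
  exact ⟨g, hg, hm, hm.restrict h h₁ h₂ h₃⟩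

theorem MorEquiv.sameClass {n i j : ℕ} (h : MorEquiv G u n i j) : SameClass G u n i j := by
  obtain ⟨g, hg, -, h⟩ := h
  exact cls_eq_iff.2 ⟨g, hg, h⟩

theorem AntiEquiv.sameClass {n i j : ℕ} (h : AntiEquiv G u n i j) : SameClass G u n i j := by
  obtain ⟨g, hg, -, h⟩ := h
  exact cls_eq_iff.2 ⟨g, hg, h⟩

theorem SameClass.symm {n i j : ℕ} (h : SameClass G u n i j) : SameClass G u n j i :=
  Eq.symm h

theorem SameClass.trans {n i j k : ℕ} (h : SameClass G u n i j) (h' : SameClass G u n j k) :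
    SameClass G u n i k :=
  Eq.trans h h'

theorem morEquiv_of_eq {n i j : ℕ} (h : factorAt u i n = factorAt u j n) :
    MorEquiv G u n i j :=
  ⟨1, G.one_mem, fun _ _ => rfl, h⟩

theorem IsSymmetryGroup.length_eq (hG : IsSymmetryGroup G) {g : Equiv.Perm (List A)}
    (hg : g ∈ G) (w : List A) : (g w).length = w.length :=
  length_symmetry (hG.morphism_or_antimorphism g hg) w

theorem SameClass.mor_or_anti (hG : IsSymmetryGroup G) {n i j : ℕ} (h : SameClass G u n i j) :
    MorEquiv G u n i j ∨ AntiEquiv G u n i j := by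
  obtain ⟨g, hg, h⟩ := cls_eq_iff.1 h
  exact (hG.morphism_or_antimorphism g hg).imp (fun hm => ⟨g, hg, hm, h⟩)
    (fun hm => ⟨g, hg, hm, h⟩)

theorem mem_language_of_infix {v w : List A} (h : v <:+: w) (hw : w ∈ language u) :
    v ∈ language u := by
  obtain ⟨i, n, rfl⟩ := hw
  obtain ⟨k, -, -, h⟩ := exists_factorAt_of_infix h
  exact ⟨k, _, h⟩

/-- A language closed under an antimorphism is recurrent: the image of a long prefix of `u`
under an antimorphism moves a factor near the beginning to one far to the right. -/
theorem exists_occurrence_ge (hG : IsSymmetryGroup G) (hu : ClosedUnder G u) {w : List A}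
    (hw : w ∈ language u) (K : ℕ) : ∃ j, K ≤ j ∧ factorAt u j w.length = w := by
  obtain ⟨g, hg, hm⟩ := hG.exists_antimorphism
  have hw' := hu w hw g⁻¹ (G.inv_mem hg)
  obtain ⟨i, n, hi⟩ := hw'
  have hn : n = w.length := by
    rw [← hG.length_eq (G.inv_mem hg) w, hi, factorAt_length]
  subst hn
  obtain ⟨j, m, hj⟩ := hu _ (factorAt_mem u 0 (i + w.length + K)) g hg
  have hm' : m = i + w.length + K := by
    rw [← factorAt_length u j m, ← hj, hG.length_eq hg, factorAt_length]
  subst hm'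
  refine ⟨j + K, by omega, ?_⟩
  rw [← hm.restrict hj (i' := i) (m := w.length) (j' := j + K) (by omega) (by omega) (by omega),
    ← hi]
  simp

theorem exists_factorAt_eq_ge (hG : IsSymmetryGroup G) (hu : ClosedUnder G u) (i n K : ℕ) :
    ∃ j, K ≤ j ∧ factorAt u j n = factorAt u i n := by
  have := exists_occurrence_ge hG hu (factorAt_mem u i n) K
  simpa [factorAt_length] using this

/-! ### Special positions and unique extension -/

/-- The factor of length `n` at position `i` is special. -/
def SpecialAt (u : ℕ → A) (n i : ℕ) : Prop := IsSpecial u (factorAt u i n)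

theorem singleton_of_letter (hG : IsSymmetryGroup G) {g : Equiv.Perm (List A)} (hg : g ∈ G)
    (a : A) : ∃ b, g [a] = [b] := by
  have := hG.length_eq hg [a]
  exact List.length_eq_one_iff.1 this

/-- Symmetries in `G` preserve special factors; an antimorphism interchanges left and right. -/
theorem IsSpecial.apply (hG : IsSymmetryGroup G) (hu : ClosedUnder G u)
    {g : Equiv.Perm (List A)} (hg : g ∈ G) {w : List A} (hw : IsSpecial u w) :
    IsSpecial u (g w) := by
  refine ⟨hu w hw.1 g hg, ?_⟩
  have inj : ∀ {a b c : A}, g [a] = [c] → g [b] = [c] → a = b := fun h h' => by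
    simpa using g.injective (h.trans h'.symm)
  rcases hw.2 with ⟨a, ha, b, hb, hab⟩ | ⟨a, ha, b, hb, hab⟩ <;>
    obtain ⟨a', ha'⟩ := singleton_of_letter hG hg a <;>
    obtain ⟨b', hb'⟩ := singleton_of_letter hG hg b <;>
    have hne : a' ≠ b' := by
      rintro rfl
      exact hab (inj ha' hb')
  · have ha := hu _ ha g hg
    have hb := hu _ hb g hg
    rw [← List.singleton_append] at ha hb
    rcases hG.morphism_or_antimorphism g hg with hm | hm
    · rw [hm, ha'] at ha
      rw [hm, hb'] at hb
      exact Or.inl ⟨a', ha, b', hb, hne⟩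
    · rw [hm, ha'] at ha
      rw [hm, hb'] at hb
      exact Or.inr ⟨a', ha, b', hb, hne⟩
  · have ha := hu _ ha g hg
    have hb := hu _ hb g hg
    rcases hG.morphism_or_antimorphism g hg with hm | hm
    · rw [hm, ha'] at ha
      rw [hm, hb'] at hb
      exact Or.inr ⟨a', ha, b', hb, hne⟩
    · rw [hm, ha'] at ha
      rw [hm, hb'] at hb
      exact Or.inl ⟨a', ha, b', hb, hne⟩

theorem SameClass.specialAt (hG : IsSymmetryGroup G) (hu : ClosedUnder G u) {n i j : ℕ}
    (h : SameClass G u n i j) (hi : SpecialAt u n i) : SpecialAt u n j := by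
  obtain ⟨g, hg, h⟩ := cls_eq_iff.1 h
  unfold SpecialAt
  rw [← h]
  exact hi.apply hG hu hg

theorem eq_of_not_special_right {w : List A} (hw : ¬ IsSpecial u w) {a b : A}
    (ha : w ++ [a] ∈ language u) (hb : w ++ [b] ∈ language u) : a = b := by
  by_contra hab
  exact hw ⟨mem_language_of_infix ⟨[], [a], by simp⟩ ha, Or.inr ⟨a, ha, b, hb, hab⟩⟩

theorem eq_of_not_special_left {w : List A} (hw : ¬ IsSpecial u w) {a b : A}
    (ha : a :: w ∈ language u) (hb : b :: w ∈ language u) : a = b := by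
  by_contra hab
  exact hw ⟨mem_language_of_infix ⟨[a], [], by simp⟩ ha, Or.inl ⟨a, ha, b, hb, hab⟩⟩

/-- A morphism taking one factor to another extends one step to the right if the suffix of
length `n` is not special. -/
theorem MorEquiv.extend_right (hG : IsSymmetryGroup G) (hu : ClosedUnder G u) {m n i j : ℕ}
    (h : MorEquiv G u (m + n) i j) (hi : ¬ SpecialAt u n (i + m)) :
    MorEquiv G u (m + n + 1) i j := by
  have hj : ¬ SpecialAt u n (j + m) := fun hj => hi (((h.restrict (m := n) (i' := i + m)
    (j' := j + m) (by omega) (by omega) (by omega)).sameClass.symm).specialAt hG hu hj)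
  obtain ⟨g, hg, hm, h⟩ := h
  refine ⟨g, hg, hm, ?_⟩
  have h1 := hu _ (factorAt_mem u i (m + n + 1)) g hg
  obtain ⟨c, hc⟩ := singleton_of_letter hG hg (u (i + (m + n)))
  rw [factorAt_succ, hm, h, hc] at h1 ⊢
  have h2 : factorAt u (j + m) n ++ [c] ∈ language u :=
    mem_language_of_infix ⟨factorAt u j m, [], by simp [factorAt_add]⟩ h1
  rw [factorAt_succ, eq_of_not_special_right hj h2
    (factorAt_succ u (j + m) n ▸ factorAt_mem u (j + m) _), Nat.add_assoc j]

theorem AntiEquiv.extend_right (hG : IsSymmetryGroup G) (hu : ClosedUnder G u) {n i j : ℕ}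
    (h : AntiEquiv G u n i (j + 1)) (hi : ¬ SpecialAt u n i) : AntiEquiv G u (n + 1) i j := by
  have hj : ¬ SpecialAt u n (j + 1) := fun hj => hi (h.sameClass.symm.specialAt hG hu hj)
  obtain ⟨g, hg, hm, h⟩ := h
  refine ⟨g, hg, hm, ?_⟩
  have h1 := hu _ (factorAt_mem u i (n + 1)) g hg
  obtain ⟨c, hc⟩ := singleton_of_letter hG hg (u (i + n))
  rw [factorAt_succ, hm, h, hc] at h1 ⊢
  rw [factorAt_succ', eq_of_not_special_left hj h1 (factorAt_succ' u j n ▸ factorAt_mem u j _)]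
  rfl

/-- A morphism taking one factor to another extends one step to the left if the prefix of
length `n` is not special. -/
theorem MorEquiv.extend_left (hG : IsSymmetryGroup G) (hu : ClosedUnder G u) {m n i j : ℕ}
    (h : MorEquiv G u (n + m) (i + 1) (j + 1)) (hi : ¬ SpecialAt u n (i + 1)) :
    MorEquiv G u (n + m + 1) i j := by
  have hj : ¬ SpecialAt u n (j + 1) := fun hj => hi (((h.restrict (m := n) (i' := i + 1)
    (j' := j + 1) (by omega) (by omega) (by omega)).sameClass.symm).specialAt hG hu hj)
  obtain ⟨g, hg, hm, h⟩ := h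
  refine ⟨g, hg, hm, ?_⟩
  have h1 := hu _ (factorAt_mem u i (n + m + 1)) g hg
  obtain ⟨c, hc⟩ := singleton_of_letter hG hg (u i)
  rw [factorAt_succ', ← List.singleton_append, hm, h, hc] at h1 ⊢
  have h2 : c :: factorAt u (j + 1) n ∈ language u :=
    mem_language_of_infix ⟨[], factorAt u (j + 1 + n) m, by simp [factorAt_add]⟩ h1
  rw [factorAt_succ', eq_of_not_special_left hj h2 (factorAt_succ' u j n ▸ factorAt_mem u j _)]
  rfl

/-- A morphism taking one factor to another extends to the right as long as no special factor
is met. -/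
theorem MorEquiv.extend_right_add (hG : IsSymmetryGroup G) (hu : ClosedUnder G u) {n i j : ℕ}
    (h : MorEquiv G u n i j) (m : ℕ) (hi : ∀ k < m, ¬ SpecialAt u n (i + k)) :
    MorEquiv G u (m + n) i j := by
  induction m with
  | zero => rwa [Nat.zero_add]
  | succ m ih =>
    have h1 := (ih fun k hk => hi k (by omega)).extend_right hG hu (hi m (by omega))
    rwa [show m + 1 + n = m + n + 1 by omega]

/-- A morphism taking one factor to another extends to the left as long as no special factor
is met. -/
theorem MorEquiv.extend_left_add (hG : IsSymmetryGroup G) (hu : ClosedUnder G u) {n l i j : ℕ}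
    (m : ℕ) (h : MorEquiv G u (n + l) (i + m) (j + m))
    (hi : ∀ k < m, ¬ SpecialAt u n (i + m - k)) : MorEquiv G u (n + (l + m)) i j := by
  induction m generalizing i j with
  | zero => exact h
  | succ m ih =>
    have h1 := ih (i := i + 1) (j := j + 1)
      (by rwa [show i + 1 + m = i + (m + 1) by omega, show j + 1 + m = j + (m + 1) by omega])
      fun k hk => by
        have := hi k (by omega)
        rwa [show i + (m + 1) = i + 1 + m by omega] at this
    have h2 := h1.extend_left hG hu (by
      have := hi m (by omega)
      rwa [show i + (m + 1) - m = i + 1 by omega] at this)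
    exact h2

/-! ### Consecutive positions -/

/-- `a < b` are consecutive elements of the set of positions `P`. -/
def Consecutive (P : ℕ → Prop) (a b : ℕ) : Prop :=
  a < b ∧ P a ∧ P b ∧ ∀ m, a < m → m < b → ¬ P m

theorem exists_consecutive_right {P : ℕ → Prop} {a b : ℕ} (ha : P a) (hb : P b) (h : a < b) :
    ∃ c, c ≤ b ∧ Consecutive P a c := by
  classical
  have hex : ∃ c, a < c ∧ P c := ⟨b, h, hb⟩
  exact ⟨Nat.find hex, Nat.find_min' hex ⟨h, hb⟩, (Nat.find_spec hex).1, ha,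
    (Nat.find_spec hex).2, fun m hm hm' hP => Nat.find_min hex hm' ⟨hm, hP⟩⟩

/-- The last position satisfying `P` before `b`. -/
theorem exists_last_lt {P : ℕ → Prop} {a b : ℕ} (ha : P a) (h : a < b) :
    ∃ c, a ≤ c ∧ c < b ∧ P c ∧ ∀ m, c < m → m < b → ¬ P m := by
  induction b with
  | zero => omega
  | succ b ih =>
    by_cases hb : P b
    · exact ⟨b, by omega, by omega, hb, fun m _ _ => by omega⟩
    · have hab : a < b := by
        rcases Nat.lt_succ_iff_lt_or_eq.1 h with h | rfl
        · exact h
        · exact absurd ha hb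
      obtain ⟨c, h1, h2, h3, h4⟩ := ih hab
      refine ⟨c, h1, by omega, h3, fun m hm hm' => ?_⟩
      rcases Nat.lt_succ_iff_lt_or_eq.1 hm' with h | rfl
      · exact h4 m hm h
      · exact hb

/-- The first position satisfying `P` after `b`. -/
theorem exists_first_gt {P : ℕ → Prop} {b c : ℕ} (hc : P c) (h : b < c) :
    ∃ d, b < d ∧ d ≤ c ∧ P d ∧ ∀ m, b < m → m < d → ¬ P m := by
  classical
  have hex : ∃ c, b < c ∧ P c := ⟨c, h, hc⟩
  exact ⟨Nat.find hex, (Nat.find_spec hex).1, Nat.find_min' hex ⟨h, hc⟩,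
    (Nat.find_spec hex).2, fun m hm hm' hP => Nat.find_min hex hm' ⟨hm, hP⟩⟩

/-- A reflexive and transitive relation that holds between consecutive elements of `P` in an
interval holds between its ends. -/
theorem chain_of_consecutive {P : ℕ → Prop} {R : ℕ → ℕ → Prop} (hrefl : ∀ a, P a → R a a)
    (htrans : ∀ a b c, R a b → R b c → R a c) {p q : ℕ}
    (hstep : ∀ a b, p ≤ a → b ≤ q → Consecutive P a b → R a b) (hpq : p ≤ q) (hp : P p)
    (hq : P q) : R p q := by
  induction hd : q - p using Nat.strong_induction_on generalizing p with
  | _ d ih =>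
    rcases hpq.eq_or_lt with rfl | hlt
    · exact hrefl _ hp
    · obtain ⟨c, hc, hcons⟩ := exists_consecutive_right hp hq hlt
      refine htrans _ _ _ (hstep _ _ le_rfl hc hcons) ?_
      have := hcons.1
      exact ih (q - c) (by omega) (fun a b ha hb => hstep a b (by omega) hb) hc hcons.2.2.1 rfl

/-! ### Edges of the graph of symmetries as pairs of consecutive special positions -/

/-- The edge traversed by `u` between the special positions `a < b`. -/
def edgeCls (G : Subgroup (Equiv.Perm (List A))) (u : ℕ → A) (n a b : ℕ) : Set (List A) :=
  cls G (factorAt u a (b - a + n))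

theorem source_factorAt (n a d : ℕ) :
    source G n (factorAt u a (d + n)) = cls G (factorAt u a n) := by
  have := drop_take_factorAt u (i := a) (n := d + n) (k := 0) (m := n) (by omega)
  rw [source, ← List.drop_zero (l := factorAt u a (d + n)), this, Nat.add_zero]

theorem target_factorAt (n a d : ℕ) :
    target G n (factorAt u a (d + n)) = cls G (factorAt u (a + d) n) := by
  rw [target, factorAt_length, Nat.add_sub_cancel, factorAt_add, List.drop_append_of_le_length
    (by simp [factorAt_length]), List.drop_of_length_le (by simp [factorAt_length]),
    List.nil_append]

theorem isEdgeWord_factorAt_iff {n a d : ℕ} :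
    IsEdgeWord u n (factorAt u a (d + n)) ↔ Consecutive (SpecialAt u n) a (a + d) := by
  have key : ∀ i, i + n ≤ (factorAt u a (d + n)).length →
      (IsSpecial u (((factorAt u a (d + n)).drop i).take n) ↔ SpecialAt u n (a + i)) := by
    intro i hi
    rw [factorAt_length] at hi
    rw [drop_take_factorAt u hi, SpecialAt]
  constructor
  · rintro ⟨-, hlen, hsp⟩
    rw [factorAt_length] at hlen
    have h : ∀ i, i ≤ d → (SpecialAt u n (a + i) ↔ i = 0 ∨ i = d) := by
      intro i hi
      have hi' : i + n ≤ (factorAt u a (d + n)).length := by rw [factorAt_length]; omega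
      rw [← key i hi', hsp i hi', factorAt_length, Nat.add_sub_cancel]
    refine ⟨by omega, (h 0 (by omega)).2 (Or.inl rfl), (h d le_rfl).2 (Or.inr rfl), ?_⟩
    intro m hm hm' hs
    obtain ⟨i, rfl⟩ := Nat.exists_eq_add_of_lt hm
    have := (h (i + 1) (by omega)).1 hs
    omega
  · rintro ⟨hlt, ha, hb, hno⟩
    refine ⟨factorAt_mem u _ _, by rw [factorAt_length]; omega, fun i hi => ?_⟩
    rw [key i hi]
    rw [factorAt_length] at hi ⊢
    rw [Nat.add_sub_cancel]
    constructor
    · intro hs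
      by_contra hne
      exact hno (a + i) (by omega) (by omega) hs
    · rintro (rfl | rfl)
      · exact ha
      · exact hb

theorem Consecutive.isEdgeWord {n a b : ℕ} (h : Consecutive (SpecialAt u n) a b) :
    IsEdgeWord u n (factorAt u a (b - a + n)) := by
  have := h.1
  rw [isEdgeWord_factorAt_iff, show a + (b - a) = b by omega]
  exact h

theorem length_eq_of_sameCls (hG : IsSymmetryGroup G) {v w : List A} (h : cls G v = cls G w) :
    v.length = w.length := by
  obtain ⟨g, hg, rfl⟩ := cls_eq_iff.1 h
  exact (hG.length_eq hg v).symm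

theorem sub_eq_of_edgeCls_eq (hG : IsSymmetryGroup G) {n a b c d : ℕ}
    (h : edgeCls G u n a b = edgeCls G u n c d) : b - a = d - c := by
  have := length_eq_of_sameCls hG h
  simpa [factorAt_length] using this

theorem AntiEquiv.consecutive (hG : IsSymmetryGroup G) (hu : ClosedUnder G u) {n a b a' : ℕ}
    (h : AntiEquiv G u (b - a + n) a a') (hc : Consecutive (SpecialAt u n) a b) :
    Consecutive (SpecialAt u n) a' (a' + (b - a)) := by
  obtain ⟨hlt, ha, hb, hno⟩ := hc
  have hr : ∀ i j, a ≤ i → i ≤ b → i + j = a' + b → SameClass G u n i j :=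
    fun i j _ _ _ => (h.restrict (i' := i) (j' := j) (m := n) (by omega) (by omega)
      (by omega)).sameClass
  refine ⟨by omega, (hr b a' (by omega) le_rfl (by omega)).specialAt hG hu hb,
    (hr a _ le_rfl (by omega) (by omega)).specialAt hG hu ha, fun m hm hm' hs => ?_⟩
  exact hno (a' + b - m) (by omega) (by omega)
    ((hr (a' + b - m) m (by omega) (by omega) (by omega)).symm.specialAt hG hu hs)

theorem MorEquiv.consecutive (hG : IsSymmetryGroup G) (hu : ClosedUnder G u) {n a b a' : ℕ}
    (h : MorEquiv G u (b - a + n) a a') (hc : Consecutive (SpecialAt u n) a b) :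
    Consecutive (SpecialAt u n) a' (a' + (b - a)) := by
  obtain ⟨hlt, ha, hb, hno⟩ := hc
  have hr : ∀ i j, a ≤ i → i ≤ b → i + a' = a + j → SameClass G u n i j :=
    fun i j _ _ _ => (h.restrict (i' := i) (j' := j) (m := n) (by omega) (by omega)
      (by omega)).sameClass
  refine ⟨by omega, (hr a a' le_rfl (by omega) (by omega)).specialAt hG hu ha,
    (hr b _ (by omega) le_rfl (by omega)).specialAt hG hu hb, fun m hm hm' hs => ?_⟩
  exact hno (a + m - a') (by omega) (by omega)
    ((hr (a + m - a') m (by omega) (by omega) (by omega)).symm.specialAt hG hu hs)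

/-- The image of a factor of `u` under an antimorphism of `G` occurs in `u`, arbitrarily far to
the right. -/
theorem exists_antiEquiv_ge (hG : IsSymmetryGroup G) (hu : ClosedUnder G u) (i n K : ℕ) :
    ∃ j, K ≤ j ∧ AntiEquiv G u n i j := by
  obtain ⟨g, hg, hm⟩ := hG.exists_antimorphism
  obtain ⟨j, hj, h⟩ := exists_occurrence_ge hG hu (hu _ (factorAt_mem u i n) g hg) K
  rw [hG.length_eq hg, factorAt_length] at h
  exact ⟨j, hj, g, hg, hm, h.symm⟩

theorem IsLink.symm {n : ℕ} {E x y : Set (List A)} (h : IsLink G u n E x y) :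
    IsLink G u n E y x := by
  obtain ⟨e, he, hE, h⟩ := h
  exact ⟨e, he, hE, h.symm⟩

/-- Every link of the graph of symmetries is traversed by `u`, arbitrarily far to the right
and in the prescribed direction, which an antimorphism reverses. -/
theorem IsLink.exists_consecutive (hG : IsSymmetryGroup G) (hu : ClosedUnder G u) {n : ℕ}
    {E x y : Set (List A)} (h : IsLink G u n E x y) (K : ℕ) :
    ∃ a b, K ≤ a ∧ Consecutive (SpecialAt u n) a b ∧ E = edgeCls G u n a b ∧
      x = cls G (factorAt u a n) ∧ y = cls G (factorAt u b n) := by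
  obtain ⟨e, he, rfl, hxy⟩ := h
  obtain ⟨i, l, rfl⟩ := he.mem_language
  obtain ⟨d, rfl⟩ : ∃ d, l = d + n := by
    have := he.length_gt
    rw [factorAt_length] at this
    exact ⟨l - n, by omega⟩
  have hc := isEdgeWord_factorAt_iff.1 he
  rw [source_factorAt, target_factorAt] at hxy
  rcases hxy with ⟨rfl, rfl⟩ | ⟨rfl, rfl⟩
  · obtain ⟨j, hj, hji⟩ := exists_factorAt_eq_ge hG hu i (d + n) K
    have hm : MorEquiv G u (d + n) i j := morEquiv_of_eq hji.symm
    refine ⟨j, j + d, hj, ?_, ?_, ?_, ?_⟩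
    · have := MorEquiv.consecutive hG hu (n := n) (a := i) (b := i + d) (a' := j)
        (by rwa [Nat.add_sub_cancel_left]) hc
      rwa [Nat.add_sub_cancel_left] at this
    · rw [edgeCls, Nat.add_sub_cancel_left]
      exact hm.sameClass
    · exact (hm.restrict (by omega) (by omega) (by omega)).sameClass
    · exact (hm.restrict (by omega) (by omega) (by omega)).sameClass
  · obtain ⟨j, hj, hm⟩ := exists_antiEquiv_ge hG hu i (d + n) K
    refine ⟨j, j + d, hj, ?_, ?_, ?_, ?_⟩
    · have := AntiEquiv.consecutive hG hu (n := n) (a := i) (b := i + d) (a' := j)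
        (by rwa [Nat.add_sub_cancel_left]) hc
      rwa [Nat.add_sub_cancel_left] at this
    · rw [edgeCls, Nat.add_sub_cancel_left]
      exact hm.sameClass
    · exact (hm.restrict (by omega) (by omega) (by omega)).sameClass
    · exact (hm.restrict (by omega) (by omega) (by omega)).sameClass

theorem Consecutive.isLink {n a b : ℕ} (h : Consecutive (SpecialAt u n) a b) :
    IsLink G u n (edgeCls G u n a b) (cls G (factorAt u a n)) (cls G (factorAt u b n)) := by
  refine ⟨_, h.isEdgeWord, rfl, Or.inl ⟨source_factorAt _ _ _, ?_⟩⟩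
  rw [target_factorAt, show a + (b - a) = b by have := h.1; omega]

/-- An edge determines its pair of end points. -/
theorem sym2_eq_of_edgeCls_eq (hG : IsSymmetryGroup G) {n a b c d : ℕ} (hab : a ≤ b)
    (hcd : c ≤ d) (h : edgeCls G u n a b = edgeCls G u n c d) :
    s(cls G (factorAt u a n), cls G (factorAt u b n)) =
      s(cls G (factorAt u c n), cls G (factorAt u d n)) := by
  have hl := sub_eq_of_edgeCls_eq hG h
  have h' : SameClass G u (b - a + n) a c := by
    have h2 := h
    unfold edgeCls at h2
    rwa [← hl] at h2
  rw [Sym2.eq_iff]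
  rcases h'.mor_or_anti hG with hm | hm
  · exact Or.inl ⟨(hm.restrict (by omega) (by omega) (by omega)).sameClass,
      (hm.restrict (by omega) (by omega) (by omega)).sameClass⟩
  · exact Or.inr ⟨(hm.restrict (by omega) (by omega) (by omega)).sameClass,
      (hm.restrict (by omega) (by omega) (by omega)).sameClass⟩

theorem SpecialAt.mem_vertexSet {n i : ℕ} (h : SpecialAt u n i) :
    cls G (factorAt u i n) ∈ vertexSet G u n :=
  ⟨_, factorAt_length u i n, h, rfl⟩

/-- The vertex of the graph of symmetries visited by `u` at the special position `i`. -/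
def SpecialAt.vertex {n i : ℕ} (h : SpecialAt u n i) : vertexSet G u n :=
  ⟨cls G (factorAt u i n), h.mem_vertexSet⟩

theorem exists_position_of_mem_vertexSet {n : ℕ} (x : vertexSet G u n) :
    ∃ i, ∃ h : SpecialAt u n i, x = h.vertex := by
  obtain ⟨x, w, rfl, hw, rfl⟩ := x
  obtain ⟨i, m, rfl⟩ := hw.1
  refine ⟨i, ?_, ?_⟩
  · rw [factorAt_length]; exact hw
  · apply Subtype.ext
    simp [SpecialAt.vertex, factorAt_length]

/-- If the graph of symmetries without its loops is a tree and `u` leaves a vertex along an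
edge that is not a loop, then it traverses the same edge again before it is back, because the
edge is a bridge. -/
theorem LooplessIsTree.exists_return {n : ℕ}
    (hT : LooplessIsTree G u n) {a b c : ℕ} (hab : Consecutive (SpecialAt u n) a b)
    (hne : ¬ SameClass G u n a b) (hbc : b ≤ c) (hca : SameClass G u n a c)
    (hc : SpecialAt u n c) :
    ∃ p q, b ≤ p ∧ q ≤ c ∧ Consecutive (SpecialAt u n) p q ∧
      edgeCls G u n p q = edgeCls G u n a b := by
  by_contra hcon
  push Not at hcon
  obtain ⟨huniq, -, hacyc⟩ := hT
  have ha := hab.2.1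
  have hb := hab.2.2.1
  have hadj : (simpleSymGraph G u n).Adj ha.vertex hb.vertex :=
    ⟨fun h => hne (congrArg Subtype.val h), _, hab.isLink⟩
  have hbr := SimpleGraph.isAcyclic_iff_forall_adj_isBridge.1 hacyc hadj
  rw [SimpleGraph.isBridge_iff] at hbr
  apply hbr
  have hchain : ∃ (h₁ : SpecialAt u n b) (h₂ : SpecialAt u n c),
      ((simpleSymGraph G u n).deleteEdges {s(ha.vertex, hb.vertex)}).Reachable
        h₁.vertex h₂.vertex := by
    refine chain_of_consecutive (P := SpecialAt u n) (R := fun i j =>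
      ∃ (h₁ : SpecialAt u n i) (h₂ : SpecialAt u n j),
      ((simpleSymGraph G u n).deleteEdges {s(ha.vertex, hb.vertex)}).Reachable
        h₁.vertex h₂.vertex) (fun i hi => ⟨hi, hi, SimpleGraph.Reachable.refl _⟩)
      (fun i j k ⟨h1, h2, h3⟩ ⟨h4, h5, h6⟩ => ⟨h1, h5, h3.trans h6⟩) ?_ hbc hb hc
    intro p q hp hq hpq
    refine ⟨hpq.2.1, hpq.2.2.1, ?_⟩
    by_cases hs : (hpq.2.1.vertex (G := G)) = hpq.2.2.1.vertex
    · rw [hs]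
    apply SimpleGraph.Adj.reachable
    rw [SimpleGraph.deleteEdges_adj]
    refine ⟨⟨hs, _, hpq.isLink⟩, fun hmem => ?_⟩
    apply hcon p q hp hq hpq
    have hends := Sym2.eq_iff.1 (Set.mem_singleton_iff.1 hmem)
    have hlink := hpq.isLink (G := G)
    apply huniq _ ha.mem_vertexSet _ hb.mem_vertexSet hne _ _ _ hab.isLink
    rcases hends with ⟨h1, h2⟩ | ⟨h1, h2⟩
    · have h1 := congrArg Subtype.val h1
      have h2 := congrArg Subtype.val h2
      simp only [SpecialAt.vertex] at h1 h2
      rwa [h1, h2] at hlink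
    · have h1 := congrArg Subtype.val h1
      have h2 := congrArg Subtype.val h2
      simp only [SpecialAt.vertex] at h1 h2
      rw [h1, h2] at hlink
      exact hlink.symm
  obtain ⟨h1, h2, h3⟩ := hchain
  have : h2.vertex (G := G) = ha.vertex := Subtype.ext hca.symm
  rw [this] at h3
  exact h3.symm

/-! ### Complete returns are palindromes in a tree-like graph -/

/-- From length `N` on, the factor of `u` between two consecutive occurrences of elements of
one class, both occurrences included, is a `G`-palindrome. -/
def ReturnsArePalindromes (G : Subgroup (Equiv.Perm (List A))) (N : ℕ) (u : ℕ → A) : Prop :=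
  ∀ n, N ≤ n → ∀ i j, Consecutive (SameClass G u n i) i j → AntiEquiv G u (j - i + n) i i

/-- The loop condition on the graph of symmetries, in terms of positions. -/
theorem LoopsArePalindromes.antiEquiv {n : ℕ} (hL : LoopsArePalindromes G u n) {a b : ℕ}
    (h : Consecutive (SpecialAt u n) a b) (hab : SameClass G u n a b) :
    AntiEquiv G u (b - a + n) a a := by
  refine hL _ h.isEdgeWord ?_
  rw [source_factorAt, target_factorAt, show a + (b - a) = b by have := h.1; omega]
  exact hab

/-- Trading distance for length: let `i` and `j + 1` be consecutive occurrences of a class of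
words of length `n`. If an antimorphism matches the words of length `n + 1` at `i` and `j`, then
`i` and `j` are consecutive occurrences of the class of these longer words. -/
theorem Consecutive.succ (hG : IsSymmetryGroup G) {n i j : ℕ}
    (h : Consecutive (SameClass G u n i) i (j + 1)) (ha : AntiEquiv G u (n + 1) i j)
    (hij : i < j) : Consecutive (SameClass G u (n + 1) i) i j := by
  refine ⟨hij, rfl, ha.sameClass, fun m hm hm' hs => ?_⟩
  rcases hs.mor_or_anti hG with hs | hs
  · exact h.2.2.2 m hm (by omega)
      (hs.restrict (m := n) (by omega) (by omega) rfl).sameClass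
  · exact h.2.2.2 (m + 1) (by omega) (by omega)
      (hs.restrict (m := n) (i' := i) (j' := m + 1) (by omega) (by omega) (by omega)).sameClass

/-- Consecutive occurrences of a class are the ends of a `G`-palindrome if the word is special
or the two occurrences are exchanged by an antimorphism. The proof lengthens the word at the
expense of the distance: either its extension is unique, or the edge of the graph of
symmetries by which `u` leaves `i` is a loop or a bridge, by which it has to enter `j`. -/
theorem antiEquiv_of_consecutive (hG : IsSymmetryGroup G) (hu : ClosedUnder G u) {N : ℕ}
    (hL : ∀ n, N ≤ n → LoopsArePalindromes G u n) (hT : ∀ n, N ≤ n → LooplessIsTree G u n)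
    {n i j : ℕ} (hn : N ≤ n) (h : Consecutive (SameClass G u n i) i j)
    (hij : SpecialAt u n i ∨ AntiEquiv G u n i j) : AntiEquiv G u (j - i + n) i i := by
  induction j generalizing n with
  | zero => exact absurd h.1 (by omega)
  | succ j ih =>
    have hlt := h.1
    -- It suffices that an antimorphism matches the words of length `n + 1`.
    suffices hs : AntiEquiv G u (n + 1) i j ∨ AntiEquiv G u (j + 1 - i + n) i i by
      rcases hs with hs | hs
      · rcases (show i ≤ j by omega).eq_or_lt with rfl | hlt'
        · rwa [show i + 1 - i + n = n + 1 by omega]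
        · have := ih (n := n + 1) (by omega) (h.succ hG hs hlt') (Or.inr hs)
          rwa [show j - i + (n + 1) = j + 1 - i + n by omega] at this
      · exact hs
    by_cases hsp : SpecialAt u n i
    · have hspj := h.2.2.1.specialAt hG hu hsp
      obtain ⟨k, hk, hik⟩ := exists_consecutive_right hsp hspj h.1
      by_cases hcl : SameClass G u n i k
      · have : k = j + 1 := by
          by_contra hne
          exact h.2.2.2 k hik.1 (by omega) hcl
        subst this
        exact Or.inr ((hL n hn).antiEquiv hik hcl)
      · obtain ⟨p, q, hp, hq, hpq, he⟩ := (hT n hn).exists_return hik hcl hk h.2.2.1 hspj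
        have hl := sub_eq_of_edgeCls_eq hG he
        have hik' := hik.1
        have hpq' := hpq.1
        have he' : SameClass G u (k - i + n) i p := by
          have h2 := he.symm
          unfold edgeCls at h2
          rwa [hl] at h2
        left
        rcases he'.mor_or_anti hG with hm | hm
        · exact absurd (hm.restrict (m := n) le_rfl (by omega) rfl).sameClass
            (h.2.2.2 p (by omega) (by omega))
        · have : q = j + 1 := by
            by_contra hne
            exact h.2.2.2 q (by omega) (by omega)
              (hm.restrict (m := n) (i' := i) (j' := q) le_rfl (by omega) (by omega)).sameClass
          subst this
          exact hm.restrict le_rfl (by omega) (by omega)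
    · exact Or.inl ((hij.resolve_left hsp).extend_right hG hu hsp)

/-- Two consecutive occurrences, at `i` and `j`, of the class of a word that is not special are
exchanged by an antimorphism when no factor of this length is special. All extensions are
then unique, so a morphism taking `i` to `j` shifts the whole word to the right of `i`. -/
theorem antiEquiv_of_no_special (hG : IsSymmetryGroup G) (hu : ClosedUnder G u) {n i j : ℕ}
    (h : Consecutive (SameClass G u n i) i j) (hno : ∀ k, ¬ SpecialAt u n k) :
    AntiEquiv G u n i j := by
  rcases h.2.2.1.mor_or_anti hG with hm | hm
  swap
  · exact hm
  -- All later occurrences would be images of the first one under morphisms.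
  have hlt := h.1
  have hall : ∀ k, i ≤ k → SameClass G u n i k → MorEquiv G u n i k := by
    intro k
    induction k using Nat.strong_induction_on with
    | _ k ih =>
      intro hik hk
      rcases hik.eq_or_lt with rfl | hik
      · exact MorEquiv.refl _ _
      have hjk : j ≤ k := by
        by_contra hjk
        exact h.2.2.2 k hik (by omega) hk
      have h1 : MorEquiv G u n (k - (j - i)) k := by
        have := hm.extend_right_add hG hu (k - j) fun _ _ => hno _
        exact this.restrict (i' := k - (j - i)) (j' := k) (by omega) (by omega) (by omega)
      exact (ih _ (by omega) (by omega) (hk.trans h1.sameClass.symm)).trans h1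
  obtain ⟨k, hk, hik⟩ := exists_antiEquiv_ge hG hu i n i
  exact (hik.trans_mor ((hall k hk hik.sameClass).symm)).trans_mor hm

/-- Two consecutive occurrences, at `i` and `j`, of the class of a word that is not special are
exchanged by an antimorphism when the word lies inside an edge of the graph of symmetries.
Otherwise a morphism would take the edge around `i` to the one around `j`. But `u` cannot pass
twice in the same direction through a bridge, and a palindromic loop contains the word in both
directions unless the word is itself a palindrome in its middle. -/
theorem antiEquiv_of_special_around (hG : IsSymmetryGroup G) (hu : ClosedUnder G u)
    {n i j s : ℕ} (hL : LoopsArePalindromes G u n) (hT : LooplessIsTree G u n)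
    (h : Consecutive (SameClass G u n i) i j) (hi : ¬ SpecialAt u n i) (hs : SpecialAt u n s)
    (hsi : s < i) : AntiEquiv G u n i j := by
  rcases h.2.2.1.mor_or_anti hG with hm | hm
  swap
  · exact hm
  have hlt := h.1
  -- The edge `a → b` around position `i`.
  obtain ⟨a, -, hai, ha, hano⟩ := exists_last_lt hs hsi
  obtain ⟨t, ht, hts⟩ := exists_factorAt_eq_ge hG hu s n (i + 1)
  have hts : SpecialAt u n t := by rw [SpecialAt, hts]; exact hs
  obtain ⟨b, hib, -, hb, hbno⟩ := exists_first_gt hts (show i < t by omega)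
  have hnos : ∀ m, a < m → m < b → ¬ SpecialAt u n m := by
    intro m h1 h2
    rcases lt_trichotomy m i with h3 | rfl | h3
    · exact hano m h1 h3
    · exact hi
    · exact hbno m h3 h2
  have hab : Consecutive (SpecialAt u n) a b := ⟨by omega, ha, hb, hnos⟩
  -- Its translate `a' → b'` around position `j`.
  have hZ : MorEquiv G u (b - a + n) a (j - (i - a)) := by
    have h1 := hm.extend_right_add hG hu (b - i) fun k hk => hnos _ (by omega) (by omega)
    have h2 := MorEquiv.extend_left_add hG hu (n := n) (l := b - i) (i := a)
      (j := j - (i - a)) (i - a) (by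
        rwa [show a + (i - a) = i by omega, show j - (i - a) + (i - a) = j by omega,
          Nat.add_comm n])
      fun k hk => hnos _ (by omega) (by omega)
    rwa [show n + (b - i + (i - a)) = b - a + n by omega] at h2
  obtain ⟨a', ha'⟩ : ∃ a', a' = j - (i - a) := ⟨_, rfl⟩
  rw [← ha'] at hZ
  have hab' := hZ.consecutive hG hu hab
  have hba' : b ≤ a' := by
    by_contra hcon
    exact hnos a' (by omega) (by omega) hab'.2.1
  by_cases hcl : SameClass G u n a b
  · -- The edge is a palindromic loop: reflect the position `i` in it, and `j` in its translate.
    have hp := hL.antiEquiv hab hcl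
    have h1 : AntiEquiv G u n i (a + b - i) :=
      hp.restrict (by omega) (by omega) (by omega)
    have h2 : ¬ i < a + b - i := fun h3 => h.2.2.2 _ h3 (by omega) h1.sameClass
    have hp' : AntiEquiv G u (b - a + n) a' a' := (hZ.symm.trans_anti hp).trans_mor hZ
    have h3 : AntiEquiv G u n j (a' + (a' + (b - a)) - j) :=
      hp'.restrict (by omega) (by omega) (by omega)
    have h4 : ¬ a' + (a' + (b - a)) - j < j := fun h4 =>
      h.2.2.2 _ (by omega) h4 (h.2.2.1.trans h3.sameClass)
    rw [show a + b - i = i by omega] at h1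
    exact h1.trans_mor hm
  · have hsc : SameClass G u n a a' :=
      (hZ.restrict (m := n) le_rfl (by omega) rfl).sameClass
    obtain ⟨p, q, hp, hq, hpq, he⟩ := hT.exists_return hab hcl hba' hsc hab'.2.1
    have hl := sub_eq_of_edgeCls_eq hG he
    have hpq' := hpq.1
    have he' : SameClass G u (b - a + n) a p := by
      have h2 := he.symm
      unfold edgeCls at h2
      rwa [hl] at h2
    exfalso
    -- The edge at `p` contains an occurrence of the class strictly between `i` and `j`.
    rcases he'.mor_or_anti hG with hq | hq
    · exact h.2.2.2 (p + (i - a)) (by omega) (by omega)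
        (hq.restrict (by omega) (by omega) (by omega)).sameClass
    · exact h.2.2.2 (p + (b - i)) (by omega) (by omega)
        (hq.restrict (by omega) (by omega) (by omega)).sameClass

theorem MorEquiv.consecutive_sameClass {n i j i' : ℕ}
    (h : MorEquiv G u (j - i + n) i i') (hc : Consecutive (SameClass G u n i) i j) :
    Consecutive (SameClass G u n i') i' (i' + (j - i)) := by
  have hlt := hc.1
  have hr : ∀ k l, i ≤ k → k ≤ j → k + i' = i + l → SameClass G u n k l :=
    fun k l _ _ _ => (h.restrict (i' := k) (j' := l) (by omega) (by omega) (by omega)).sameClass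
  have h0 := hr i i' le_rfl (by omega) (by omega)
  refine ⟨by omega, rfl, h0.symm.trans (hc.2.2.1.trans (hr j _ (by omega) le_rfl (by omega))),
    fun m hm hm' hs => ?_⟩
  exact hc.2.2.2 (i + m - i') (by omega) (by omega)
    (h0.trans (hs.trans (hr (i + m - i') m (by omega) (by omega) (by omega)).symm))

theorem returnsArePalindromes_of_tls (hG : IsSymmetryGroup G) (hu : ClosedUnder G u) {N : ℕ}
    (hL : ∀ n, N ≤ n → LoopsArePalindromes G u n) (hT : ∀ n, N ≤ n → LooplessIsTree G u n) :
    ReturnsArePalindromes G N u := by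
  intro n hn i j h
  by_cases hi : SpecialAt u n i
  · exact antiEquiv_of_consecutive hG hu hL hT hn h (Or.inl hi)
  by_cases hex : ∃ s, SpecialAt u n s
  · -- Move the complete return behind a special position.
    obtain ⟨s, hs⟩ := hex
    obtain ⟨i', hi', heq⟩ := exists_factorAt_eq_ge hG hu i (j - i + n) (s + 1)
    have hm : MorEquiv G u (j - i + n) i i' := morEquiv_of_eq heq.symm
    have h' := hm.consecutive_sameClass h
    have hsi : ¬ SpecialAt u n i' := fun h2 => hi
      ((hm.restrict (m := n) le_rfl (by omega) rfl).sameClass.symm.specialAt hG hu h2)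
    have := antiEquiv_of_consecutive hG hu hL hT hn h' (Or.inr
      (antiEquiv_of_special_around hG hu (hL n hn) (hT n hn) h' hsi hs (by omega)))
    rw [Nat.add_sub_cancel_left] at this
    exact (hm.trans_anti this).trans_mor hm.symm
  · exact antiEquiv_of_consecutive hG hu hL hT hn h (Or.inr
      (antiEquiv_of_no_special hG hu h fun k hk => hex ⟨k, hk⟩))

/-! ### The graph is tree-like if complete returns are palindromes -/

/-- After its last visit to the vertex `x` before reaching position `m`, the word `u` has left
`x` along the edge `E`. -/
def BranchAt (G : Subgroup (Equiv.Perm (List A))) (u : ℕ → A) (n : ℕ) (x E : Set (List A))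
    (m : ℕ) : Prop :=
  ∃ a b, a < m ∧ cls G (factorAt u a n) = x ∧
    (∀ k, a < k → k ≤ m → cls G (factorAt u k n) ≠ x) ∧
    Consecutive (SpecialAt u n) a b ∧ E = edgeCls G u n a b

theorem BranchAt.eq {n m : ℕ} {x E E' : Set (List A)} (h : BranchAt G u n x E m)
    (h' : BranchAt G u n x E' m) : E = E' := by
  obtain ⟨a, b, ham, ha, hno, hab, rfl⟩ := h
  obtain ⟨c, d, hcm, hc, hno', hcd, rfl⟩ := h'
  have hac : a = c := by
    rcases lt_trichotomy a c with h | h | h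
    · exact absurd hc (hno c h hcm.le)
    · exact h
    · exact absurd ha (hno' a h ham.le)
  subst hac
  have hbd : b = d := by
    rcases lt_trichotomy b d with h | h | h
    · exact absurd hab.2.2.1 (hcd.2.2.2 b hab.1 h)
    · exact h
    · exact absurd hcd.2.2.1 (hab.2.2.2 d hcd.1 h)
  rw [hbd]

theorem exists_branchAt {n m s : ℕ} {x : Set (List A)} (hs : s < m)
    (hx : cls G (factorAt u s n) = x) (hxs : ∀ k, cls G (factorAt u k n) = x → SpecialAt u n k)
    (hm : SpecialAt u n m) (hmx : cls G (factorAt u m n) ≠ x) :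
    ∃ E, BranchAt G u n x E m := by
  obtain ⟨a, -, ham, ha, hno⟩ :=
    exists_last_lt (P := fun k => cls G (factorAt u k n) = x) hx hs
  obtain ⟨b, -, hab⟩ := exists_consecutive_right (hxs a ha) hm ham
  refine ⟨_, a, b, ham, ha, fun k hk hkm => ?_, hab, rfl⟩
  rcases hkm.eq_or_lt with rfl | hkm
  · exact hmx
  · exact hno k hk hkm

theorem BranchAt.of_le {n m m' : ℕ} {x E : Set (List A)} (h : BranchAt G u n x E m)
    (hmm : m ≤ m') (hno : ∀ k, m < k → k ≤ m' → cls G (factorAt u k n) ≠ x) :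
    BranchAt G u n x E m' := by
  obtain ⟨a, b, ham, ha, hno', hab, rfl⟩ := h
  refine ⟨a, b, by omega, ha, fun k hk hkm => ?_, hab, rfl⟩
  rcases le_or_gt k m with h | h
  · exact hno' k hk h
  · exact hno k h hkm

/-- Two consecutive visits of a vertex `z ≠ x` lie in the same branch at `x`: if `u` visits `x`
in between, then it first comes to `x` along the edge by which it had left `x`, because its
excursion from `x` is a palindrome, and it last leaves `x` along that same edge, because its
excursion from `z` is a palindrome. -/
theorem BranchAt.of_consecutive (hG : IsSymmetryGroup G) (hu : ClosedUnder G u) {n : ℕ}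
    (hR : ∀ i j, Consecutive (SameClass G u n i) i j → AntiEquiv G u (j - i + n) i i)
    {m m' : ℕ} {x E : Set (List A)} (h : BranchAt G u n x E m) (hm : SpecialAt u n m)
    (hmm : Consecutive (SameClass G u n m) m m') : BranchAt G u n x E m' := by
  have hlt := hmm.1
  by_cases hno : ∀ k, m < k → k ≤ m' → cls G (factorAt u k n) ≠ x
  · exact h.of_le hlt.le hno
  push Not at hno
  obtain ⟨k, hmk, hkm', hk⟩ := hno
  obtain ⟨a, b, ham, ha, hno, hab, rfl⟩ := h
  have hmx : cls G (factorAt u m n) ≠ x := hno m ham le_rfl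
  have hmx' : cls G (factorAt u m' n) ≠ x := fun h => hmx (Eq.trans hmm.2.2.1 h)
  have hab1 := hab.1
  -- `p` is the first visit of `x` between `m` and `m'`.
  obtain ⟨p, hmp, hpk, hp, hpno⟩ :=
    exists_first_gt (P := fun k => cls G (factorAt u k n) = x) hk hmk
  have hpm' : p < m' := by
    rcases (show p ≤ m' by omega).eq_or_lt with rfl | h
    · exact absurd hp hmx'
    · exact h
  have hxexc : Consecutive (SameClass G u n a) a p := by
    refine ⟨by omega, rfl, ha.trans hp.symm, fun t hat htp hs => ?_⟩
    rcases le_or_gt t m with h | h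
    · exact hno t hat h (Eq.trans hs.symm ha)
    · exact hpno t h htp (Eq.trans hs.symm ha)
  have hbm : b ≤ m := by
    by_contra hcon
    exact hab.2.2.2 m ham (by omega) hm
  -- The edge `b' → p` is the mirror image of `a → b`.
  have h1 : AntiEquiv G u (b - a + n) a (a + p - b) :=
    (hR a p hxexc).restrict le_rfl (by omega) (by omega)
  have hb'p := h1.consecutive hG hu hab
  have hmb' : m ≤ a + p - b := by
    by_contra hcon
    exact hb'p.2.2.2 m (by omega) (by omega) hm
  have hz := hR m m' hmm
  have h2 : AntiEquiv G u (b - a + n) (a + p - b) (m + m' - p) :=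
    hz.restrict hmb' (by omega) (by omega)
  have h3 := h1.trans h2
  have hrefl : ∀ s t, m ≤ s → s ≤ m' → s + t = m + m' → SameClass G u n s t :=
    fun s t _ _ _ => (hz.restrict (i' := s) (j' := t) (by omega) (by omega) (by omega)).sameClass
  refine ⟨m + m' - p, m + m' - p + (b - a), by omega, ?_, ?_, h3.consecutive hG hu hab, ?_⟩
  · exact Eq.trans (hrefl p (m + m' - p) (by omega) (by omega) (by omega)).symm hp
  · intro t ht htm hx
    rcases htm.eq_or_lt with rfl | htm
    · exact hmx' hx
    · exact hpno (m + m' - t) (by omega) (by omega)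
        (Eq.trans (hrefl t (m + m' - t) (by omega) (by omega) (by omega)).symm hx)
  · rw [edgeCls, edgeCls, Nat.add_sub_cancel_left]
    exact h3.sameClass

theorem BranchAt.of_sameClass (hG : IsSymmetryGroup G) (hu : ClosedUnder G u) {n : ℕ}
    (hR : ∀ i j, Consecutive (SameClass G u n i) i j → AntiEquiv G u (j - i + n) i i)
    {m m' : ℕ} {x E : Set (List A)} (h : BranchAt G u n x E m) (hm : SpecialAt u n m)
    (hle : m ≤ m') (hmm : SameClass G u n m m') : BranchAt G u n x E m' := by
  refine chain_of_consecutive (P := SameClass G u n m)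
    (R := fun a b => BranchAt G u n x E a → BranchAt G u n x E b) (fun _ _ => id)
    (fun _ _ _ h1 h2 => h2 ∘ h1) ?_ hle rfl hmm h
  intro a b _ _ hab hba
  have hma : SameClass G u n m a := hab.2.1
  exact hba.of_consecutive hG hu hR (hma.specialAt hG hu hm)
    ⟨hab.1, rfl, hma.symm.trans hab.2.2.1, fun t h1 h2 h3 =>
      hab.2.2.2 t h1 h2 (hma.trans h3)⟩

/-- The branch at `x` in which a vertex lies does not depend on the visit. -/
theorem BranchAt.unique (hG : IsSymmetryGroup G) (hu : ClosedUnder G u) {n : ℕ}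
    (hR : ∀ i j, Consecutive (SameClass G u n i) i j → AntiEquiv G u (j - i + n) i i)
    {m m' : ℕ} {x E E' : Set (List A)} (h : BranchAt G u n x E m)
    (h' : BranchAt G u n x E' m') (hm : SpecialAt u n m) (hmm : SameClass G u n m m') :
    E = E' := by
  rcases le_total m m' with hle | hle
  · exact (h.of_sameClass hG hu hR hm hle hmm).eq h'
  · exact h.eq (h'.of_sameClass hG hu hR (hmm.specialAt hG hu hm) hle hmm.symm)

/-- When `u` arrives at a vertex along an edge that is not a loop, the vertex lies in the branch
of this edge. -/
theorem Consecutive.branchAt (hG : IsSymmetryGroup G) (hu : ClosedUnder G u) {n a b : ℕ}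
    (h : Consecutive (SpecialAt u n) a b) (hne : ¬ SameClass G u n a b) :
    BranchAt G u n (cls G (factorAt u a n)) (edgeCls G u n a b) b := by
  refine ⟨a, b, h.1, rfl, fun k hk hkb hx => ?_, h, rfl⟩
  rcases hkb.eq_or_lt with rfl | hkb
  · exact hne (Eq.symm hx)
  · exact h.2.2.2 k hk hkb (SameClass.specialAt hG hu (Eq.symm hx) h.2.1)

theorem simpleSymGraph_preconnected (n : ℕ) : (simpleSymGraph G u n).Preconnected := by
  have key : ∀ i j, i ≤ j → ∀ (hi : SpecialAt u n i) (hj : SpecialAt u n j),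
      (simpleSymGraph G u n).Reachable hi.vertex hj.vertex := by
    intro i j hij hi hj
    obtain ⟨h1, h2, h3⟩ := chain_of_consecutive (P := SpecialAt u n) (R := fun i j =>
      ∃ (h₁ : SpecialAt u n i) (h₂ : SpecialAt u n j),
      (simpleSymGraph G u n).Reachable h₁.vertex h₂.vertex)
      (fun i hi => ⟨hi, hi, SimpleGraph.Reachable.refl _⟩)
      (fun i j k ⟨h1, h2, h3⟩ ⟨h4, h5, h6⟩ => ⟨h1, h5, h3.trans h6⟩) (p := i) (q := j)
      (fun a b _ _ hab => by
        refine ⟨hab.2.1, hab.2.2.1, ?_⟩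
        by_cases hs : (hab.2.1.vertex (G := G)) = hab.2.2.1.vertex
        · rw [hs]
        · exact SimpleGraph.Adj.reachable ⟨hs, _, hab.isLink⟩) hij hi hj
    exact h3
  intro x y
  obtain ⟨i, hi, rfl⟩ := exists_position_of_mem_vertexSet x
  obtain ⟨j, hj, rfl⟩ := exists_position_of_mem_vertexSet y
  rcases le_total i j with h | h
  · exact key i j h hi hj
  · exact (key j i h hj hi).symm

/-- If complete returns are palindromes, the branch of an edge at `x` can be left only through
this edge. So every edge that is not a loop is a bridge, and there are no multiple edges. -/
theorem looplessIsTree_of_returns (hG : IsSymmetryGroup G) (hu : ClosedUnder G u) {n : ℕ}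
    (hR : ∀ i j, Consecutive (SameClass G u n i) i j → AntiEquiv G u (j - i + n) i i) :
    LooplessIsTree G u n := by
  refine ⟨?_, simpleSymGraph_preconnected n, ?_⟩
  · intro x _ y _ hxy E E' hE hE'
    obtain ⟨a, b, -, hab, rfl, rfl, rfl⟩ := hE.exists_consecutive hG hu 0
    obtain ⟨c, d, -, hcd, rfl, hac, hbd⟩ := hE'.exists_consecutive hG hu 0
    have h1 := hab.branchAt hG hu hxy
    have h2 := hcd.branchAt hG hu (G := G) (fun h => hxy (hac.trans (Eq.trans h hbd.symm)))
    rw [← hac] at h2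
    exact h1.unique hG hu hR h2 hab.2.2.1 hbd
  · rw [SimpleGraph.isAcyclic_iff_forall_adj_isBridge]
    intro x y hxy
    rw [SimpleGraph.isBridge_iff]
    rintro ⟨w⟩
    obtain ⟨hne, E, hE⟩ := hxy
    have hne' : x.1 ≠ y.1 := fun h => hne (Subtype.ext h)
    obtain ⟨a, b, -, hab, rfl, hxa, hyb⟩ := hE.exists_consecutive hG hu 0
    have hxs : ∀ k, cls G (factorAt u k n) = x.1 → SpecialAt u n k := fun k hk =>
      SameClass.specialAt hG hu (Eq.symm (hk.trans hxa)) hab.2.1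
    -- The branch of `y` at `x` is closed under adjacency away from the removed edge.
    have hclosed : ∀ z z' : vertexSet G u n,
        ((simpleSymGraph G u n).deleteEdges {s(x, y)}).Walk z z' →
        (∃ m, SpecialAt u n m ∧ cls G (factorAt u m n) = z.1 ∧
          BranchAt G u n x.1 (edgeCls G u n a b) m) →
        (∃ m, SpecialAt u n m ∧ cls G (factorAt u m n) = z'.1 ∧
          BranchAt G u n x.1 (edgeCls G u n a b) m) := by
      intro z z' w
      induction w with
      | nil => exact id
      | @cons z z₁ z' hadj _ ih =>
        rintro ⟨m, hm, hmz, hbr⟩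
        apply ih
        rw [SimpleGraph.deleteEdges_adj] at hadj
        obtain ⟨⟨hzne, F, hF⟩, hnot⟩ := hadj
        have hzne' : z.1 ≠ z₁.1 := fun h => hzne (Subtype.ext h)
        by_cases hz₁ : z₁ = x
        · subst hz₁
          obtain ⟨c, d, -, hcd, -, hxc, hzd⟩ := hF.symm.exists_consecutive hG hu 0
          have h2 := hcd.branchAt hG hu (G := G)
            (fun h => hzne' (hzd.trans (Eq.trans h.symm hxc.symm)))
          rw [← hxc] at h2
          have h3 := hbr.unique hG hu hR h2 hm (hmz.trans hzd)
          have h4 := sym2_eq_of_edgeCls_eq hG hab.1.le hcd.1.le h3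
          rw [← hxa, ← hyb, ← hxc, ← hzd] at h4
          exfalso
          apply hnot
          rw [Set.mem_singleton_iff, Sym2.eq_swap]
          apply Sym2.map.injective Subtype.val_injective
          simpa using h4.symm
        · obtain ⟨c, d, hac, hcd, -, hzc, hzd⟩ := hF.exists_consecutive hG hu (a + 1)
          have hzx : cls G (factorAt u c n) ≠ x.1 := fun h => by
            obtain ⟨a', -, ham, -, hno, -⟩ := hbr
            exact hno m ham le_rfl (hmz.trans (hzc.trans h))
          have hzx' : cls G (factorAt u d n) ≠ x.1 := fun h =>
            hz₁ (Subtype.ext (hzd.trans h))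
          obtain ⟨E', hE'⟩ := exists_branchAt (show a < c by omega) hxa.symm hxs hcd.2.1 hzx
          obtain rfl := hbr.unique hG hu hR hE' hm (hmz.trans hzc)
          refine ⟨d, hcd.2.2.1, hzd.symm, hE'.of_le hcd.1.le fun k hk hkd => ?_⟩
          rcases hkd.eq_or_lt with rfl | hkd
          · exact hzx'
          · exact fun h => hcd.2.2.2 k hk hkd (hxs k h)
    have hbr := hab.branchAt hG hu (G := G) (fun h => hne' (hxa.trans (Eq.trans h hyb.symm)))
    rw [← hxa] at hbr
    obtain ⟨m, -, hmx, a', -, ham, -, hno, -⟩ :=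
      hclosed y x w.reverse ⟨b, hab.2.2.1, hyb.symm, hbr⟩
    exact hno m ham le_rfl hmx

/-- A loop is a complete return to the class of its end points, because no other special factors
occur in it. -/
theorem loopsArePalindromes_of_returns (hG : IsSymmetryGroup G) (hu : ClosedUnder G u) {n : ℕ}
    (hR : ∀ i j, Consecutive (SameClass G u n i) i j → AntiEquiv G u (j - i + n) i i) :
    LoopsArePalindromes G u n := by
  intro e he hst
  obtain ⟨i, l, rfl⟩ := he.mem_language
  obtain ⟨d, rfl⟩ : ∃ d, l = d + n := by
    have := he.length_gt
    rw [factorAt_length] at this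
    exact ⟨l - n, by omega⟩
  have hc := isEdgeWord_factorAt_iff.1 he
  rw [source_factorAt, target_factorAt] at hst
  have := hR i (i + d) ⟨hc.1, rfl, hst, fun m hm hm' hs =>
    hc.2.2.2 m hm hm' (hs.specialAt hG hu hc.2.1)⟩
  rwa [Nat.add_sub_cancel_left] at this

/-- The tree-like structure of the graphs of symmetries from order `N` on means that complete
returns to classes of words of length at least `N` are palindromes. -/
theorem hasTLS_iff_returnsArePalindromes (hG : IsSymmetryGroup G) (hu : ClosedUnder G u)
    {N : ℕ} : HasTLS G N u ↔ ReturnsArePalindromes G N u :=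
  ⟨fun h => returnsArePalindromes_of_tls hG hu h.loops h.tree, fun h =>
    ⟨hu, fun n hn => loopsArePalindromes_of_returns hG hu (h n hn),
      fun n hn => looplessIsTree_of_returns hG hu (h n hn)⟩⟩

/-! ### The defect of a factor and of its one-letter extensions -/

/-- Being a `G`-palindrome is a property of the class. -/
theorem AntiEquiv.conj (hG : IsSymmetryGroup G) {n i j : ℕ} (h : AntiEquiv G u n i i)
    (hij : SameClass G u n i j) : AntiEquiv G u n j j := by
  rcases hij.mor_or_anti hG with hm | hm
  · exact (hm.symm.trans_anti h).trans_mor hm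
  · exact (hm.symm.trans h).trans_anti hm

theorem eq_of_cls_factorAt_eq (hG : IsSymmetryGroup G) {m k m' k' : ℕ}
    (h : cls G (factorAt u k m) = cls G (factorAt u k' m')) : m = m' := by
  simpa [factorAt_length] using length_eq_of_sameCls hG h

theorem mem_palClasses_factorAt {i n : ℕ} {x : Set (List A)} :
    x ∈ palClasses G (factorAt u i n) ↔
      ∃ k m, i ≤ k ∧ k + m ≤ i + n ∧ AntiEquiv G u m k k ∧ x = cls G (factorAt u k m) := by
  constructor
  · rintro ⟨v, hv, hp, rfl⟩
    obtain ⟨k, h1, h2, h3⟩ := exists_factorAt_of_infix hv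
    refine ⟨k, v.length, h1, h2, ?_, by rw [← h3]⟩
    rw [h3] at hp
    exact hp
  · rintro ⟨k, m, h1, h2, hp, rfl⟩
    exact ⟨_, factorAt_infix u h1 h2, hp, rfl⟩

theorem mem_factorAt {i n : ℕ} {a : A} :
    a ∈ factorAt u i n ↔ ∃ k, i ≤ k ∧ k < i + n ∧ u k = a := by
  simp only [factorAt, List.mem_map, List.mem_range]
  constructor
  · rintro ⟨k, hk, rfl⟩
    exact ⟨i + k, by omega, by omega, rfl⟩
  · rintro ⟨k, h1, h2, rfl⟩
    exact ⟨k - i, by omega, by rw [show i + (k - i) = k by omega]⟩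

theorem mem_unfixedLetterClasses_factorAt {i n : ℕ} {x : Set (List A)} :
    x ∈ unfixedLetterClasses G (factorAt u i n) ↔
      ∃ k, i ≤ k ∧ k < i + n ∧ ¬ AntiEquiv G u 1 k k ∧ x = cls G (factorAt u k 1) := by
  have hfix : ∀ k, (∀ g ∈ G, IsAntimorphism g → g [u k] ≠ [u k]) ↔ ¬ AntiEquiv G u 1 k k := by
    intro k
    rw [AntiEquiv, factorAt_one]
    push Not
    rfl
  constructor
  · rintro ⟨a, ha, hne, rfl⟩
    obtain ⟨k, h1, h2, rfl⟩ := mem_factorAt.1 ha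
    exact ⟨k, h1, h2, (hfix k).1 hne, by rw [factorAt_one]⟩
  · rintro ⟨k, h1, h2, hne, rfl⟩
    exact ⟨u k, mem_factorAt.2 ⟨k, h1, h2, rfl⟩, (hfix k).2 hne, by rw [factorAt_one]⟩

theorem palClasses_finite (w : List A) : (palClasses G w).Finite := by
  have h : {v : List A | v <:+: w}.Finite :=
    (List.finite_toSet w.sublists).subset fun v hv => List.mem_sublists.2 hv.sublist
  refine (h.image (cls G)).subset ?_
  rintro x ⟨v, hv, -, rfl⟩
  exact ⟨v, hv, rfl⟩

theorem unfixedLetterClasses_finite (w : List A) : (unfixedLetterClasses G w).Finite := by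
  refine ((List.finite_toSet w).image fun a => cls G [a]).subset ?_
  rintro x ⟨a, ha, -, rfl⟩
  exact ⟨a, ha, rfl⟩

theorem palClasses_mono {i n : ℕ} :
    palClasses G (factorAt u i n) ⊆ palClasses G (factorAt u i (n + 1)) := by
  rintro x ⟨v, hv, hp, rfl⟩
  exact ⟨v, hv.trans (factorAt_infix u le_rfl (by omega)), hp, rfl⟩

theorem unfixedLetterClasses_mono {i n : ℕ} :
    unfixedLetterClasses G (factorAt u i n) ⊆
      unfixedLetterClasses G (factorAt u i (n + 1)) := by
  rintro x ⟨a, ha, hne, rfl⟩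
  exact ⟨a, (factorAt_infix u le_rfl (by omega)).subset ha, hne, rfl⟩

/-- A class of palindromes that appears with the last letter is represented by a suffix. -/
theorem exists_suffix_of_new_palClass {i n : ℕ} {x : Set (List A)}
    (hx : x ∈ palClasses G (factorAt u i (n + 1)))
    (hx' : x ∉ palClasses G (factorAt u i n)) :
    ∃ k m, i ≤ k ∧ k + m = i + n + 1 ∧ AntiEquiv G u m k k ∧ x = cls G (factorAt u k m) := by
  rw [mem_palClasses_factorAt] at hx hx'
  obtain ⟨k, m, h1, h2, h3, h4⟩ := hx
  refine ⟨k, m, h1, ?_, h3, h4⟩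
  by_contra hne
  exact hx' ⟨k, m, h1, by omega, h3, h4⟩

/-- Of the palindromic suffixes only the longest can be new: the others are mirrored to
its beginning. -/
theorem new_palClass_unique {i n : ℕ} {x y : Set (List A)}
    (hx : x ∈ palClasses G (factorAt u i (n + 1))) (hx' : x ∉ palClasses G (factorAt u i n))
    (hy : y ∈ palClasses G (factorAt u i (n + 1))) (hy' : y ∉ palClasses G (factorAt u i n)) :
    x = y := by
  obtain ⟨k, m, h1, h2, h3, rfl⟩ := exists_suffix_of_new_palClass hx hx'
  obtain ⟨k', m', h1', h2', h3', rfl⟩ := exists_suffix_of_new_palClass hy hy'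
  have key : ∀ {k m k' m' : ℕ}, i ≤ k → k + m = i + n + 1 → AntiEquiv G u m k k →
      k' + m' = i + n + 1 → AntiEquiv G u m' k' k' → k < k' →
      cls G (factorAt u k' m') ∈ palClasses G (factorAt u i n) := by
    intro k m k' m' h1 h2 h3 h2' h3' hlt
    have h : AntiEquiv G u m' k' k := h3.restrict (by omega) (by omega) (by omega)
    exact mem_palClasses_factorAt.2
      ⟨k, m', h1, by omega, (h.symm.trans h3').trans_anti h, h.sameClass⟩
  rcases lt_trichotomy k k' with h | rfl | h
  · exact absurd (key h1 h2 h3 h2' h3' h) hy'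
  · rw [show m = m' by omega]
  · exact absurd (key h1' h2' h3' h2 h3 h) hx'

/-- A class of unfixed letters that appears with the last letter is the class of this letter. -/
theorem new_letterClass_eq {i n : ℕ} {y : Set (List A)}
    (hy : y ∈ unfixedLetterClasses G (factorAt u i (n + 1)))
    (hy' : y ∉ unfixedLetterClasses G (factorAt u i n)) :
    y = cls G (factorAt u (i + n) 1) ∧ ¬ AntiEquiv G u 1 (i + n) (i + n) := by
  rw [mem_unfixedLetterClasses_factorAt] at hy hy'
  obtain ⟨k, h1, h2, h3, h4⟩ := hy
  have : k = i + n := by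
    by_contra hne
    exact hy' ⟨k, h1, by omega, h3, h4⟩
  subst this
  exact ⟨h4, h3⟩

/-- A letter never brings both a new class of palindromes and a new class of unfixed letters:
in a palindromic suffix of length at least two the last letter is mirrored to the first one. -/
theorem not_new_both (hG : IsSymmetryGroup G) {i n : ℕ} {x y : Set (List A)}
    (hx : x ∈ palClasses G (factorAt u i (n + 1))) (hx' : x ∉ palClasses G (factorAt u i n))
    (hy : y ∈ unfixedLetterClasses G (factorAt u i (n + 1)))
    (hy' : y ∉ unfixedLetterClasses G (factorAt u i n)) : False := by
  obtain ⟨k, m, h1, h2, h3, rfl⟩ := exists_suffix_of_new_palClass hx hx'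
  obtain ⟨rfl, h4⟩ := new_letterClass_eq hy hy'
  rcases m.eq_zero_or_pos with rfl | hm
  · apply hx'
    rw [mem_palClasses_factorAt]
    exact ⟨i, 0, le_rfl, by omega, h3, rfl⟩
  · have h5 : AntiEquiv G u 1 (i + n) k := h3.restrict (by omega) (by omega) (by omega)
    rcases (show k ≤ i + n by omega).eq_or_lt with rfl | hlt
    · exact h4 h5
    · apply hy'
      rw [mem_unfixedLetterClasses_factorAt]
      exact ⟨k, h1, hlt, fun h => h4 (h.conj hG h5.symm.sameClass), h5.sameClass⟩

theorem defect_factorAt (i n : ℕ) :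
    defect G (factorAt u i n) = (n : ℤ) + 1 - ((palClasses G (factorAt u i n)).ncard : ℤ) -
      ((unfixedLetterClasses G (factorAt u i n)).ncard : ℤ) := by
  rw [defect, gammaG, factorAt_length]

theorem defect_le_defect_succ (hG : IsSymmetryGroup G) (i n : ℕ) :
    defect G (factorAt u i n) ≤ defect G (factorAt u i (n + 1)) := by
  rw [defect_factorAt, defect_factorAt]
  suffices h : (palClasses G (factorAt u i (n + 1))).ncard +
      (unfixedLetterClasses G (factorAt u i (n + 1))).ncard ≤
      (palClasses G (factorAt u i n)).ncard +
        (unfixedLetterClasses G (factorAt u i n)).ncard + 1 by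
    push_cast
    omega
  by_cases hp : palClasses G (factorAt u i (n + 1)) ⊆ palClasses G (factorAt u i n)
  · have h1 := Set.ncard_le_ncard hp (palClasses_finite _)
    have h2 : unfixedLetterClasses G (factorAt u i (n + 1)) ⊆
        insert (cls G (factorAt u (i + n) 1)) (unfixedLetterClasses G (factorAt u i n)) := by
      intro y hy
      by_cases hy' : y ∈ unfixedLetterClasses G (factorAt u i n)
      · exact Or.inr hy'
      · exact Or.inl (new_letterClass_eq hy hy').1
    have h3 := Set.ncard_le_ncard h2 ((unfixedLetterClasses_finite _).insert _)
    have h4 := Set.ncard_insert_le (cls G (factorAt u (i + n) 1))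
      (unfixedLetterClasses G (factorAt u i n))
    omega
  · obtain ⟨x, hx, hx'⟩ := Set.not_subset.1 hp
    have h1 : unfixedLetterClasses G (factorAt u i (n + 1)) ⊆
        unfixedLetterClasses G (factorAt u i n) := by
      intro y hy
      by_contra hy'
      exact not_new_both hG hx hx' hy hy'
    have h2 : palClasses G (factorAt u i (n + 1)) ⊆
        insert x (palClasses G (factorAt u i n)) := by
      intro y hy
      by_cases hy' : y ∈ palClasses G (factorAt u i n)
      · exact Or.inr hy'
      · exact Or.inl (new_palClass_unique hy hy' hx hx')
    have h3 := Set.ncard_le_ncard h1 (unfixedLetterClasses_finite _)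
    have h4 := Set.ncard_le_ncard h2 ((palClasses_finite _).insert _)
    have h5 := Set.ncard_insert_le x (palClasses G (factorAt u i n))
    omega

/-- Appending a letter preserves the defect exactly when it brings a new class of palindromes
or a new class of unfixed letters. -/
theorem defect_succ_le_iff {i n : ℕ} :
    defect G (factorAt u i (n + 1)) ≤ defect G (factorAt u i n) ↔
      ¬ palClasses G (factorAt u i (n + 1)) ⊆ palClasses G (factorAt u i n) ∨
      ¬ unfixedLetterClasses G (factorAt u i (n + 1)) ⊆
        unfixedLetterClasses G (factorAt u i n) := by
  rw [defect_factorAt, defect_factorAt]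
  have hp := Set.ncard_le_ncard (palClasses_mono (G := G) (u := u) (i := i) (n := n))
    (palClasses_finite _)
  have hl := Set.ncard_le_ncard (unfixedLetterClasses_mono (G := G) (u := u) (i := i) (n := n))
    (unfixedLetterClasses_finite _)
  constructor
  · intro h
    by_contra hcon
    push Not at hcon
    rw [hcon.1.antisymm palClasses_mono, hcon.2.antisymm unfixedLetterClasses_mono] at h
    push_cast at h
    omega
  · rintro (h | h)
    · have := Set.ncard_lt_ncard ⟨palClasses_mono, h⟩
        (palClasses_finite _)
      push_cast
      omega
    · have := Set.ncard_lt_ncard ⟨unfixedLetterClasses_mono, h⟩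
        (unfixedLetterClasses_finite _)
      push_cast
      omega

theorem AntiEquiv.palClasses_subset (hG : IsSymmetryGroup G) {n i j : ℕ}
    (h : AntiEquiv G u n i j) :
    palClasses G (factorAt u i n) ⊆ palClasses G (factorAt u j n) := by
  intro x hx
  rw [mem_palClasses_factorAt] at hx ⊢
  obtain ⟨k, m, h1, h2, h3, rfl⟩ := hx
  have h4 : AntiEquiv G u m k (i + j + n - k - m) := h.restrict h1 h2 (by omega)
  exact ⟨_, m, by omega, by omega, h3.conj hG h4.sameClass, h4.sameClass⟩

theorem AntiEquiv.unfixedLetterClasses_subset (hG : IsSymmetryGroup G) {n i j : ℕ}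
    (h : AntiEquiv G u n i j) :
    unfixedLetterClasses G (factorAt u i n) ⊆ unfixedLetterClasses G (factorAt u j n) := by
  intro x hx
  rw [mem_unfixedLetterClasses_factorAt] at hx ⊢
  obtain ⟨k, h1, h2, h3, rfl⟩ := hx
  have h4 : AntiEquiv G u 1 k (i + j + n - k - 1) := h.restrict h1 (by omega) (by omega)
  exact ⟨_, by omega, by omega, fun h5 => h3 (h5.conj hG h4.sameClass.symm), h4.sameClass⟩

theorem AntiEquiv.defect_eq (hG : IsSymmetryGroup G) {n i j : ℕ} (h : AntiEquiv G u n i j) :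
    defect G (factorAt u i n) = defect G (factorAt u j n) := by
  rw [defect_factorAt, defect_factorAt,
    (h.palClasses_subset hG).antisymm (h.symm.palClasses_subset hG),
    (h.unfixedLetterClasses_subset hG).antisymm (h.symm.unfixedLetterClasses_subset hG)]

/-- The defect is monotone for the factor order. Extensions to the left are turned into
extensions to the right by an antimorphism, which preserves the defect. -/
theorem defect_factorAt_mono (hG : IsSymmetryGroup G) (hu : ClosedUnder G u) {i n k m : ℕ}
    (h₁ : i ≤ k) (h₂ : k + m ≤ i + n) :
    defect G (factorAt u k m) ≤ defect G (factorAt u i n) := by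
  have hright : ∀ i m d, defect G (factorAt u i m) ≤ defect G (factorAt u i (m + d)) := by
    intro i m d
    induction d with
    | zero => exact le_rfl
    | succ d ih => exact ih.trans (defect_le_defect_succ hG i (m + d))
  have h3 := hright k m (i + n - k - m)
  rw [show m + (i + n - k - m) = i + n - k by omega] at h3
  refine h3.trans ?_
  obtain ⟨j, -, hj⟩ := exists_antiEquiv_ge hG hu i n 0
  have h4 : AntiEquiv G u (i + n - k) k j := hj.restrict h₁ (by omega) (by omega)
  rw [hj.defect_eq hG, h4.defect_eq hG]
  have h5 := hright j (i + n - k) (k - i)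
  rwa [show i + n - k + (k - i) = n by omega] at h5

theorem defect_nil (hG : IsSymmetryGroup G) : defect G ([] : List A) = 0 := by
  have h1 : palClasses G ([] : List A) = {cls G []} := by
    ext x
    constructor
    · rintro ⟨v, hv, -, rfl⟩
      rw [List.infix_nil.1 hv]
      rfl
    · rintro rfl
      obtain ⟨g, hg, hm⟩ := hG.exists_antimorphism
      exact ⟨[], List.infix_rfl, ⟨g, hg, hm, hm.map_nil⟩, rfl⟩
  have h2 : unfixedLetterClasses G ([] : List A) = ∅ := by
    ext x
    simp [unfixedLetterClasses]
  simp [defect, gammaG, h1, h2]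

/-! ### Defect and complete returns -/

/-- If the last letter of a complete return does not increase the defect, then the complete
return is a palindrome, because a palindromic suffix which is new must be all of it. -/
theorem antiEquiv_of_defect_le (hG : IsSymmetryGroup G) {n i j l : ℕ}
    (h : Consecutive (SameClass G u n i) i j) (hn : 0 < n) (hl : l + 1 = j - i + n)
    (hd : defect G (factorAt u i (l + 1)) ≤ defect G (factorAt u i l)) :
    AntiEquiv G u (j - i + n) i i := by
  have hlt := h.1
  rcases defect_succ_le_iff.1 hd with hd | hd
  · obtain ⟨x, hx, hx'⟩ := Set.not_subset.1 hd
    obtain ⟨k, m, h1, h2, h3, rfl⟩ := exists_suffix_of_new_palClass hx hx'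
    rcases le_or_gt m n with hmn | hmn
    · -- A suffix of length at most `n` has its class represented in the prefix of length `n`.
      exfalso
      apply hx'
      rw [mem_palClasses_factorAt]
      obtain ⟨k', hk', hk'', hkk⟩ : ∃ k', i ≤ k' ∧ k' + m ≤ i + n ∧ SameClass G u m k k' := by
        rcases h.2.2.1.symm.mor_or_anti hG with hm | hm
        · exact ⟨k + i - j, by omega, by omega,
            (hm.restrict (by omega) (by omega) (by omega)).sameClass⟩
        · exact ⟨i + j + n - m - k, by omega, by omega,
            (hm.restrict (by omega) (by omega) (by omega)).sameClass⟩
      exact ⟨k', m, hk', by omega, h3.conj hG hkk, hkk⟩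
    · -- The suffix mirrors the occurrence at `j` to its own beginning `k`.
      have h4 : AntiEquiv G u n j k := h3.restrict (by omega) (by omega) (by omega)
      have hki : k = i := by
        by_contra hne
        exact h.2.2.2 k (by omega) (by omega) (h.2.2.1.trans h4.sameClass)
      subst hki
      rwa [show m = j - k + n by omega] at h3
  · -- The last letter is not new: its class occurs in the prefix of length `n`.
    exfalso
    obtain ⟨y, hy, hy'⟩ := Set.not_subset.1 hd
    obtain ⟨rfl, h4⟩ := new_letterClass_eq hy hy'
    apply hy'
    rw [mem_unfixedLetterClasses_factorAt]
    obtain ⟨k', hk', hk'', hkk⟩ : ∃ k', i ≤ k' ∧ k' + 1 ≤ i + n ∧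
        SameClass G u 1 (i + l) k' := by
      rcases h.2.2.1.symm.mor_or_anti hG with hm | hm
      · exact ⟨i + l + i - j, by omega, by omega,
          (hm.restrict (by omega) (by omega) (by omega)).sameClass⟩
      · exact ⟨i + j + n - 1 - (i + l), by omega, by omega,
          (hm.restrict (by omega) (by omega) (by omega)).sameClass⟩
    exact ⟨k', hk', by omega, fun h5 => h4 (h5.conj hG hkk.symm), hkk⟩

/-- If complete returns are palindromes and the class of the suffix of length `N` of a prefix
of `u` has occurred before, then the longest palindromic suffix of this prefix is new. -/
theorem defect_prefix_succ_le (hG : IsSymmetryGroup G) {N t k : ℕ}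
    (hR : ReturnsArePalindromes G N u) (ht : k + N ≤ t)
    (hk : SameClass G u N k (t + 1 - N)) :
    defect G (factorAt u 0 (t + 1)) ≤ defect G (factorAt u 0 t) := by
  classical
  -- Going back from an earlier occurrence of the class of a suffix to the last one.
  have hlonger : ∀ m s k, N ≤ m → s + m = t + 1 → k < s → SameClass G u m s k →
      ∃ c < s, AntiEquiv G u (t + 1 - c) c c := by
    intro m s k hm hs hks hsk
    obtain ⟨c, -, hcs, hc, hno⟩ := exists_last_lt (P := SameClass G u m s) hsk hks
    have hsc : SameClass G u m s c := hc
    have := hR m hm c s ⟨hcs, rfl, hsc.symm, fun q h1 h2 h3 => hno q h1 h2 (hsc.trans h3)⟩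
    rw [show s - c + m = t + 1 - c by omega] at this
    exact ⟨c, hcs, this⟩
  obtain ⟨c, hcN, hc⟩ := hlonger N (t + 1 - N) k le_rfl (by omega) (by omega) hk.symm
  have hex : ∃ c, AntiEquiv G u (t + 1 - c) c c := ⟨c, hc⟩
  have hcmin := Nat.find_min' hex hc
  have hspec := Nat.find_spec hex
  have hmin : ∀ m, m < Nat.find hex → ¬ AntiEquiv G u (t + 1 - m) m m :=
    fun m hm => Nat.find_min hex hm
  generalize Nat.find hex = s at hcmin hspec hmin
  rw [defect_succ_le_iff]
  left
  intro hsub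
  have hmem : cls G (factorAt u s (t + 1 - s)) ∈ palClasses G (factorAt u 0 (t + 1)) :=
    mem_palClasses_factorAt.2 ⟨s, t + 1 - s, by omega, by omega, hspec, rfl⟩
  obtain ⟨k', m', -, h2, -, h4⟩ := mem_palClasses_factorAt.1 (hsub hmem)
  have hm' := eq_of_cls_factorAt_eq hG h4
  subst hm'
  obtain ⟨c', hc', hp⟩ := hlonger (t + 1 - s) s k' (by omega) (by omega) (by omega) h4
  exact hmin c' hc' hp

/-- For `N = 1` no prefix of `u` is exempt: a letter whose class has not occurred before is
itself a new palindrome or a new unfixed letter. -/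
theorem defect_prefix_succ_le_of_one (hG : IsSymmetryGroup G)
    (hR : ReturnsArePalindromes G 1 u) (t : ℕ) :
    defect G (factorAt u 0 (t + 1)) ≤ defect G (factorAt u 0 t) := by
  by_cases hex : ∃ k < t, SameClass G u 1 k t
  · obtain ⟨k, hk, hkt⟩ := hex
    exact defect_prefix_succ_le hG hR (by omega) hkt
  rw [defect_succ_le_iff]
  by_cases hp : AntiEquiv G u 1 t t
  · left
    intro hsub
    obtain ⟨k, m, -, h2, -, h4⟩ := mem_palClasses_factorAt.1
      (hsub (mem_palClasses_factorAt.2 ⟨t, 1, by omega, by omega, hp, rfl⟩))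
    obtain rfl := eq_of_cls_factorAt_eq hG h4
    exact hex ⟨k, by omega, h4.symm⟩
  · right
    intro hsub
    obtain ⟨k, -, h2, -, h4⟩ := mem_unfixedLetterClasses_factorAt.1
      (hsub (mem_unfixedLetterClasses_factorAt.2 ⟨t, by omega, by omega, hp, rfl⟩))
    exact hex ⟨k, by omega, h4.symm⟩

/-- The defect of the prefixes of `u` is constant after all factors of length `N` have occurred. -/
theorem exists_defect_bound [Finite A] (hG : IsSymmetryGroup G) (hu : ClosedUnder G u) {N : ℕ}
    (hR : ReturnsArePalindromes G N u) : ∃ K : ℤ, ∀ w ∈ language u, defect G w ≤ K := by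
  -- All factors of length `N` have occurred before position `p`.
  obtain ⟨p, hp⟩ : ∃ p, ∀ i, ∃ k < p, factorAt u k N = factorAt u i N := by
    have hfin : (Set.range fun i => factorAt u i N).Finite :=
      (List.finite_length_eq A N).subset (by
        rintro _ ⟨i, rfl⟩
        exact factorAt_length u i N)
    choose! f hf using fun (w : List A) (hw : w ∈ Set.range fun i => factorAt u i N) => hw
    obtain ⟨b, hb⟩ := (hfin.image f).bddAbove
    refine ⟨b + 1, fun i => ⟨f (factorAt u i N), ?_, hf _ ⟨i, rfl⟩⟩⟩
    exact Nat.lt_succ_of_le (hb ⟨_, ⟨i, rfl⟩, rfl⟩)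
  have hconst : ∀ d, defect G (factorAt u 0 (p + N + d)) ≤ defect G (factorAt u 0 (p + N)) := by
    intro d
    induction d with
    | zero => exact le_rfl
    | succ d ih =>
      refine le_trans ?_ ih
      obtain ⟨k, hk, hkp⟩ := hp (p + N + d + 1 - N)
      exact defect_prefix_succ_le (t := p + N + d) hG hR (by omega) (morEquiv_of_eq hkp).sameClass
  refine ⟨defect G (factorAt u 0 (p + N)), ?_⟩
  rintro _ ⟨i, n, rfl⟩
  exact (defect_factorAt_mono hG hu (i := 0) (n := p + N + (i + n)) (by omega) (by omega)).trans
    (hconst _)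

/-- In a uniformly recurrent word with a language closed under `G`, every factor occurs in all
sufficiently long factors. -/
theorem IsUniformlyRecurrent.exists_window (hG : IsSymmetryGroup G) (hu : ClosedUnder G u)
    (hur : IsUniformlyRecurrent u) (p n : ℕ) :
    ∃ M, ∀ i, ∃ k, i ≤ k ∧ k ≤ i + M ∧ factorAt u k n = factorAt u p n := by
  set P : ℕ → Prop := fun k => factorAt u k n = factorAt u p n with hP
  obtain ⟨B, hB⟩ := ((hur _ (factorAt_mem u p n)).image List.length).bddAbove
  have hgap : ∀ a b, Consecutive P a b → b ≤ a + B := by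
    intro a b hab
    have hlt := hab.1
    have : (factorAt u a (b - a + n)).length ≤ B := by
      apply hB
      refine ⟨_, ⟨factorAt_mem u _ _, by simp only [factorAt_length]; omega, ?_⟩, rfl⟩
      intro i
      simp only [OccursAt, factorAt_length]
      constructor
      · rintro ⟨h1, h2⟩
        rw [drop_take_factorAt u h1] at h2
        by_contra hne
        exact hab.2.2.2 (a + i) (by omega) (by omega) h2
      · intro h
        refine ⟨by omega, ?_⟩
        rw [drop_take_factorAt u (by omega)]
        rcases h with rfl | rfl
        · exact hab.2.1
        · rw [show a + (b - a + n - n) = b by omega]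
          exact hab.2.2.1
    rw [factorAt_length] at this
    omega
  refine ⟨p + B, fun i => ?_⟩
  rcases le_or_gt i p with hip | hip
  · exact ⟨p, hip, by omega, rfl⟩
  by_cases hPi : P i
  · exact ⟨i, le_rfl, by omega, hPi⟩
  obtain ⟨a, -, hai, ha, hano⟩ := exists_last_lt (P := P) rfl hip
  obtain ⟨t, ht, hPt⟩ := exists_factorAt_eq_ge hG hu p n (i + 1)
  obtain ⟨b, hib, -, hb, hbno⟩ := exists_first_gt (P := P) hPt (show i < t by omega)
  have := hgap a b ⟨by omega, ha, hb, fun m h1 h2 h3 => by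
    rcases lt_trichotomy m i with h | rfl | h
    · exact hano m h1 h h3
    · exact hPi h3
    · exact hbno m h h2 h3⟩
  exact ⟨b, hib.le, by omega, hb⟩

/-- Complete returns to words long enough to contain a factor of maximal defect do not gain
defect at their last letter, so they are palindromes. -/
theorem returnsArePalindromes_of_defect_bound (hG : IsSymmetryGroup G) (hu : ClosedUnder G u)
    (hur : IsUniformlyRecurrent u) {K : ℤ} (hK : ∀ w ∈ language u, defect G w ≤ K) :
    ∃ N, ReturnsArePalindromes G N u := by
  -- The defect attains its maximum, and from some length on every factor has this defect.
  obtain ⟨D, ⟨w, ⟨p, m, rfl⟩, rfl⟩, hmax⟩ := Int.exists_greatest_of_bdd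
    (P := fun z => ∃ w ∈ language u, defect G w = z)
    ⟨K, by rintro z ⟨w, hw, rfl⟩; exact hK w hw⟩ ⟨_, _, factorAt_mem u 0 0, rfl⟩
  obtain ⟨M, hM⟩ := hur.exists_window hG hu p m
  refine ⟨M + m + 1, fun n hn i j h => ?_⟩
  have hlt := h.1
  refine antiEquiv_of_defect_le hG h (by omega) (l := j - i + n - 1) (by omega) ?_
  obtain ⟨k, hk, hk', hkp⟩ := hM i
  refine (hmax _ ⟨_, factorAt_mem u _ _, rfl⟩).trans ?_
  rw [← hkp]
  exact defect_factorAt_mono hG hu hk (by omega)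

theorem infDefect_le_iff {K : ℤ} :
    infDefect G u ≤ (((K : ℤ) : ℝ) : EReal) ↔ ∀ w ∈ language u, defect G w ≤ K := by
  simp only [infDefect, iSup_le_iff, EReal.coe_le_coe_iff, Int.cast_le]

theorem infDefect_eq_zero_iff (hG : IsSymmetryGroup G) (hu : ClosedUnder G u) :
    infDefect G u = 0 ↔ ReturnsArePalindromes G 1 u := by
  have h0 : (0 : EReal) ≤ infDefect G u := by
    have := le_iSup₂ (f := fun w (_ : w ∈ language u) => (((defect G w : ℤ) : ℝ) : EReal)) []
      (factorAt_mem u 0 0)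
    rw [defect_nil hG] at this
    simpa [infDefect] using this
  have hle : infDefect G u = 0 ↔ ∀ w ∈ language u, defect G w ≤ 0 := by
    rw [← infDefect_le_iff]
    simp only [Int.cast_zero, EReal.coe_zero]
    exact ⟨fun h => h.le, fun h => h.antisymm h0⟩
  rw [hle]
  constructor
  · intro h n hn i j hij
    have hlt := hij.1
    refine antiEquiv_of_defect_le hG hij (by omega) (l := j - i + n - 1) (by omega) ?_
    refine (h _ (factorAt_mem u _ _)).trans ?_
    rw [← defect_nil hG, ← factorAt_zero u i]
    exact defect_factorAt_mono hG hu le_rfl (by omega)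
  · rintro hR _ ⟨i, n, rfl⟩
    have hpre : ∀ t, defect G (factorAt u 0 t) ≤ 0 := by
      intro t
      induction t with
      | zero => exact (defect_nil hG).le
      | succ t ih => exact (defect_prefix_succ_le_of_one hG hR t).trans ih
    exact (defect_factorAt_mono hG hu (i := 0) (n := i + n) (by omega) (by omega)).trans (hpre _)

theorem infDefect_lt_top_iff [Finite A] (hG : IsSymmetryGroup G) (hu : ClosedUnder G u)
    (hur : IsUniformlyRecurrent u) :
    infDefect G u < ⊤ ↔ ∃ N, ReturnsArePalindromes G N u := by
  constructor
  · intro h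
    obtain ⟨r, hr, -⟩ := EReal.lt_iff_exists_real_btwn.1 h
    have hK : infDefect G u ≤ (((⌈r⌉ : ℤ) : ℝ) : EReal) :=
      hr.le.trans (EReal.coe_le_coe_iff.2 (Int.le_ceil r))
    exact returnsArePalindromes_of_defect_bound hG hu hur (infDefect_le_iff.1 hK)
  · rintro ⟨N, hR⟩
    obtain ⟨K, hK⟩ := exists_defect_bound hG hu hR
    exact (infDefect_le_iff.2 hK).trans_lt (EReal.coe_lt_top _)

end SymWords

theorem mainTheorem3 {A : Type*} [Finite A] (G : Subgroup (Equiv.Perm (List A)))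
    (hG : SymWords.IsSymmetryGroup G) (u : ℕ → A) (hu : SymWords.ClosedUnder G u) :
    (SymWords.infDefect G u = 0 ↔ SymWords.IsGRich G u) ∧
    (SymWords.IsUniformlyRecurrent u →
      (SymWords.infDefect G u < ⊤ ↔ SymWords.IsAlmostGRich G u)) := by
  refine ⟨?_, fun hur => ?_⟩
  · rw [SymWords.infDefect_eq_zero_iff hG hu, SymWords.IsGRich,
      SymWords.hasTLS_iff_returnsArePalindromes hG hu]
  · rw [SymWords.infDefect_lt_top_iff hG hu hur, SymWords.IsAlmostGRich]
    exact exists_congr fun N => (SymWords.hasTLS_iff_returnsArePalindromes hG hu).symm
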